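/- **Conventions.** Boxes are indexed by (row, column), rows counted downwards. A *shape* $D$ is a finite set of boxes. A semi-standard tableau $M=(m_c)_{c\in D}\in\mathrm{SSYT}(D)$ is a filling of $D$ by positive integers that is weakly increasing along rows and strictly increasing down columns. For complex variables $\boldsymbol s=(s_c)_{c\in D}$ the Schur multiple zeta-function is $$\zeta_D(\boldsymbol s)=\sum_{M\in\mathrm{SSYT}(D)}\ \prod_{c\in D} m_c^{-s_c}.$$ A corner of $D$ is a box of $D$ with no box of $D$ directly to its right or directly below it, and $W_D$ is the set of $\boldsymbol s$ with $\Re s_c\ge 1$ for all $c\in D$ and $\Re s_c>1$ for all corners $c$. For a partition $\lambda$, $W_\lambda^{\rm diag}$ is the set of $\boldsymbol s=(s_{ij})\in W_\lambda$ such that $s_{ij}=z_{j-i}$ depends only on $j-i$. Let $\lambda$ be a partition of a positive integer, with conjugate $\lambda'$, let $N$ be the number of boxes on its main diagonal, and let $\lambda=(p_1,\dots,p_N\mid q_1,\dots,q_N)$ be its Frobenius notation, $p_i=\lambda_i-i$, $q_i=\lambda_i'-i$. Let $\lambda_*$, $\lambda^*$ be (possibly empty) skew Young diagrams. For a Young diagram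 $\mu$, the laced shape $[\lambda_*\mid\mu\mid\lambda^*]$ is obtained by pasting the right edge of the most north-east box of $\lambda_*$ to the left edge of the most south-west box of $\mu$, and the bottom edge of the most south-west box of $\lambda^*$ to the top edge of the most north-east box of $\mu$ (an empty piece is omitted); $[\boldsymbol s_*\mid\boldsymbol s\mid\boldsymbol s^*]$ denotes the corresponding variables on it. Let $\boldsymbol s\in W_\lambda^{\rm diag}$, $\boldsymbol s_*\in W_{\lambda_*}$, $\boldsymbol s^*\in W_{\lambda^*}$, and put $\widetilde\lambda=[\lambda_*\mid\lambda\mid\lambda^*]$, $\widetilde{\boldsymbol s}=[\boldsymbol s_*\mid\boldsymbol s\mid\boldsymbol s^*]$. For $1\le i,j\le N$ let $\lambda_{ij}$ be the hook $(p_i+1,1^{q_j})$ with variables $\boldsymbol s^F_{ij}$ given by $z_0,z_1,\dots,z_{p_i}$ along its row and $z_0,z_{-1},\dots,z_{-q_j}$ down its column. Let $\widetilde\lambda_{ij}$, $\widetilde{\boldsymbol s}^F_{ij}$ be obtained from $\lambda_{ij}$, $\boldsymbol s^F_{ij}$ by attaching $\lambda^*$, $\boldsymbol s^*$ at the north-east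 if $i=1$ (and nothing there if $i>1$), and $\lambda_*$, $\boldsymbol s_*$ at the south-west if $j=1$ (and nothing there if $j>1$). Put $\widetilde\zeta_{i,j}=\zeta_{\widetilde\lambda_{ij}}(\widetilde{\boldsymbol s}^F_{ij})$. **Theorem.** The series $\zeta_{\widetilde\lambda}(\widetilde{\boldsymbol s})$ converges absolutely. If $\boldsymbol s^F_{ij}\in W_{\lambda_{ij}}$ for all $1\le i,j\le N$, then all the series $\widetilde\zeta_{i,j}$ converge absolutely and $$\zeta_{\widetilde\lambda}(\widetilde{\boldsymbol s})=\det\bigl(\widetilde\zeta_{i,j}\bigr)_{1\le i,j\le N}.$$ For arbitrary $\boldsymbol s\in W_\lambda^{\rm diag}$ the formula holds with the right-hand side understood as a continuous extension: with $\boldsymbol s_*,\boldsymbol s^*$ fixed, $\det(\widetilde\zeta_{i,j})$ evaluated at $\boldsymbol s'$ tends to $\zeta_{\widetilde\lambda}(\widetilde{\boldsymbol s})$ as $\boldsymbol s'\to\boldsymbol s$ within the set of those $\boldsymbol s'\in W_\lambda^{\rm diag}$ for which all the hook variables $\boldsymbol s'^F_{ij}$ lie in $W_{\lambda_{ij}}$.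 -/

import Mathlib

namespace LacedSchur

/-- A box, in matrix coordinates `(row, column)`: rows are counted downwards, columns to the
right. The upper left box of the Young diagram of a partition is `(0, 0)`. -/
abbrev Box : Type := ℤ × ℤ

/-- The boxes of the Young diagram of a partition. -/
def youngBoxes (lam : YoungDiagram) : Finset Box :=
  lam.cells.image fun c => ((c.1 : ℤ), (c.2 : ℤ))

/-- A skew Young diagram: the set difference of two Young diagrams `inner ⊆ outer`
(possibly empty; `inner = ⊥` gives an ordinary Young diagram). -/
structure SkewDiagram where
  outer : YoungDiagram
  inner : YoungDiagram
  inner_le : inner ≤ outer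

/-- The boxes of a skew Young diagram. -/
def SkewDiagram.boxes (θ : SkewDiagram) : Finset Box :=
  youngBoxes θ.outer \ youngBoxes θ.inner

/-- Semi-standard tableaux of shape `D`: weakly increasing along rows, strictly increasing
down columns. -/
def IsSSYT (D : Finset Box) (T : D → ℕ+) : Prop :=
  (∀ a b : D, a.1.1 = b.1.1 → a.1.2 < b.1.2 → T a ≤ T b) ∧
  (∀ a b : D, a.1.2 = b.1.2 → a.1.1 < b.1.1 → T a < T b)

/-- The type of all semi-standard tableaux of shape `D` with positive integer entries. -/
def SSYT (D : Finset Box) : Type := {T : D → ℕ+ // IsSSYT D T}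

/-- The weight `1 / M ^ s`. Tableaux of variables on `D` are functions on all boxes of which
only the values on `D` matter. -/
noncomputable def weight (D : Finset Box) (s : Box → ℂ) (M : SSYT D) : ℂ :=
  ∏ c : D, 1 / (((M.1 c : ℕ) : ℂ) ^ s c.1)

/-- The defining series of the Schur multiple zeta-function converges absolutely. -/
def AbsConv (D : Finset Box) (s : Box → ℂ) : Prop :=
  Summable fun M : SSYT D => ‖weight D s M‖

/-- The Schur multiple zeta-function attached to the shape `D`. -/
noncomputable def schurZeta (D : Finset Box) (s : Box → ℂ) : ℂ :=
  ∑' M : SSYT D, weight D s M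

/-- The corners of `D`: boxes of `D` with no box of `D` directly to the right or below. -/
def corners (D : Finset Box) : Finset Box :=
  D.filter fun c => (c.1, c.2 + 1) ∉ D ∧ (c.1 + 1, c.2) ∉ D

/-- The domain `W_D`. -/
def W (D : Finset Box) : Set (Box → ℂ) :=
  {s | (∀ c ∈ D, c ∉ corners D → 1 ≤ (s c).re) ∧ (∀ c ∈ corners D, 1 < (s c).re)}

/-- The domain `W_λ^diag`: elements of `W_λ` that are constant along diagonals. -/
def Wdiag (lam : YoungDiagram) : Set (Box → ℂ) :=
  {s | s ∈ W (youngBoxes lam) ∧ ∀ a ∈ youngBoxes lam, ∀ b ∈ youngBoxes lam,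
    a.2 - a.1 = b.2 - b.1 → s a = s b}

/-- The most north-east box of a (non-empty skew) diagram. -/
noncomputable def neBox (D : Finset Box) : Box :=
  (sInf (Prod.fst '' (D : Set Box)), sSup (Prod.snd '' (D : Set Box)))

/-- The most south-west box of a (non-empty skew) diagram. -/
noncomputable def swBox (D : Finset Box) : Box :=
  (sSup (Prod.fst '' (D : Set Box)), sInf (Prod.snd '' (D : Set Box)))

/-- The translation that puts the most north-east box of `A` directly to the left of the most
south-west box of `D`. -/
noncomputable def swShift (A D : Finset Box) : Box := swBox D - (0, 1) - neBox A

/-- The translation that puts the most south-west box of `B` directly above the most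
north-east box of `D`. -/
noncomputable def neShift (D B : Finset Box) : Box := neBox D - (1, 0) - swBox B

/-- The laced shape `[A | D | B]`. -/
noncomputable def laced (A D B : Finset Box) : Finset Box :=
  A.image (fun c => c + swShift A D) ∪ D ∪ B.image (fun c => c + neShift D B)

/-- The variables `[sA | s | sB]` on the laced shape `[A | D | B]`. -/
noncomputable def lacedVar (A D B : Finset Box) (sA s sB : Box → ℂ) : Box → ℂ := fun c =>
  if c ∈ D then s c
  else if c - swShift A D ∈ A then sA (c - swShift A D)
  else sB (c - neShift D B)

/-- The number `N` of boxes on the main diagonal. -/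
def diagLen (lam : YoungDiagram) : ℕ := (lam.cells.filter fun c => c.1 = c.2).card

/-- The Frobenius coordinate `p` of the row with index `i` (indices start at `0`). -/
def frobP (lam : YoungDiagram) (i : ℕ) : ℕ := lam.rowLen i - (i + 1)

/-- The Frobenius coordinate `q` of the column with index `j` (indices start at `0`). -/
def frobQ (lam : YoungDiagram) (j : ℕ) : ℕ := lam.colLen j - (j + 1)

/-- The hook `(p + 1, 1 ^ q)`. -/
def hook (p q : ℕ) : Finset Box :=
  (Finset.range (p + 1)).image (fun c : ℕ => ((0 : ℤ), (c : ℤ))) ∪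
    (Finset.range (q + 1)).image (fun r : ℕ => ((r : ℤ), (0 : ℤ)))

/-- The content variable `z_k` of a tableau that is constant along diagonals, read off from
the first row and the first column. -/
def contentVar (s : Box → ℂ) (k : ℤ) : ℂ := if 0 ≤ k then s (0, k) else s (-k, 0)

/-- The variables on a hook: `z_0, z_1, …` along the row, `z_0, z_{-1}, …` down the column. -/
def hookVar (s : Box → ℂ) : Box → ℂ := fun c => contentVar s (c.2 - c.1)

/-- All the tableaux of variables on the hooks `(p_i + 1, 1 ^ q_j)` lie in the domains `W` of
these hooks. -/
def HooksInW (lam : YoungDiagram) (s : Box → ℂ) : Prop :=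
  ∀ i j : Fin (diagLen lam), hookVar s ∈ W (hook (frobP lam i) (frobQ lam j))

/-- The part attached at the south-west of the hook in position `(i, j)`:
the whole diagram for the first column, nothing otherwise. -/
def swPart (A : Finset Box) (j : ℕ) : Finset Box := if j = 0 then A else ∅

/-- The part attached at the north-east of the hook in position `(i, j)`:
the whole diagram for the first row, nothing otherwise. -/
def nePart (B : Finset Box) (i : ℕ) : Finset Box := if i = 0 then B else ∅

/-- The laced hook in position `(i, j)`. -/
noncomputable def lacedHook (lam : YoungDiagram) (A B : Finset Box) (i j : ℕ) : Finset Box :=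
  laced (swPart A j) (hook (frobP lam i) (frobQ lam j)) (nePart B i)

/-- The variables on the laced hook in position `(i, j)`. -/
noncomputable def lacedHookVar (lam : YoungDiagram) (A B : Finset Box) (sA s sB : Box → ℂ)
    (i j : ℕ) : Box → ℂ :=
  lacedVar (swPart A j) (hook (frobP lam i) (frobQ lam j)) (nePart B i) sA (hookVar s) sB

/-- The `N × N` matrix of the Schur multiple zeta-functions of the laced hooks. -/
noncomputable def giambelliMatrix (lam : YoungDiagram) (A B : Finset Box)
    (sA s sB : Box → ℂ) : Matrix (Fin (diagLen lam)) (Fin (diagLen lam)) ℂ :=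
  Matrix.of fun i j =>
    schurZeta (lacedHook lam A B i j) (lacedHookVar lam A B sA s sB i j)

end LacedSchur

namespace LacedSchur

open Finset Matrix

/-! ### Cauchy–Binet and column operations on determinants -/

section Determinants

variable {R : Type*} [CommRing R]

/-- The Cauchy–Binet formula. -/
theorem det_sum_mul {V : Type*} [LinearOrder V] [Fintype V] {N : ℕ} (A B : Fin N → V → R) :
    det (of fun i j => ∑ v, A i v * B j v) =
      ∑ m : Fin N → V with StrictMono m,
        det (of fun i k => A i (m k)) * det (of fun j k => B j (m k)) := by
  have h1 : det (of fun i j => ∑ v, A i v * B j v) =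
      ∑ f : Fin N → V, det (of fun i j => A i (f j)) * ∏ j, B j (f j) := by
    simp only [det_apply', of_apply, prod_univ_sum, Fintype.piFinset_univ, mul_sum, sum_mul]
    rw [Finset.sum_comm]
    simp only [prod_mul_distrib, mul_assoc]
  -- A non-injective `f` produces two equal columns.
  have h2 : ∑ f : Fin N → V, det (of fun i j => A i (f j)) * ∏ j, B j (f j) =
      ∑ f : Fin N → V with Function.Injective f,
        det (of fun i j => A i (f j)) * ∏ j, B j (f j) := by
    refine (sum_subset (filter_subset _ _) fun f _ hf => ?_).symm
    have hf' : ¬ Function.Injective f := fun h => hf (mem_filter.2 ⟨mem_univ _, h⟩)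
    simp only [Function.Injective, not_forall] at hf'
    obtain ⟨a, b, hab, hne⟩ := hf'
    rw [det_zero_of_column_eq hne (fun i => by simp [hab]), zero_mul]
  have h3 : ∀ m : Fin N → V,
      det (of fun i k => A i (m k)) * det (of fun j k => B j (m k)) =
        ∑ σ : Equiv.Perm (Fin N),
          det (of fun i j => A i (m (σ j))) * ∏ j, B j (m (σ j)) := by
    intro m
    rw [← det_transpose (of fun j k => B j (m k)), det_apply' (of fun j k => B j (m k))ᵀ, mul_sum]
    refine Finset.sum_congr rfl fun σ _ => ?_
    have := det_permute' σ (of fun i k => A i (m k))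
    simp only [submatrix, of_apply, id] at this
    rw [this]
    simp only [transpose_apply, of_apply]
    ring
  rw [h1, h2]
  simp only [h3]
  rw [← sum_product']
  symm
  -- An injective map is uniquely an increasing map after a permutation; the permutation is found by
  -- sorting.
  refine sum_bij (fun x _ => x.1 ∘ x.2) ?_ ?_ ?_ ?_
  · rintro ⟨m, σ⟩ h
    simp only [mem_product, mem_filter, mem_univ, true_and, and_true] at h ⊢
    exact h.injective.comp σ.injective
  · rintro ⟨m, σ⟩ h ⟨m', σ'⟩ h' e
    simp only [mem_product, mem_filter, mem_univ, true_and, and_true] at h h' e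
    have hr : Set.range m = Set.range m' := by
      rw [← σ.surjective.range_comp m, e, σ'.surjective.range_comp]
    have hm : m = m' := (StrictMono.range_inj h h').1 hr
    subst hm
    have : σ = σ' := Equiv.ext fun j => h.injective (congrFun e j)
    rw [this]
  · intro f hf
    simp only [mem_filter, mem_univ, true_and] at hf
    refine ⟨(f ∘ Tuple.sort f, (Tuple.sort f)⁻¹), ?_, ?_⟩
    · simp only [mem_product, mem_filter, mem_univ, true_and, and_true]
      exact (Tuple.monotone_sort f).strictMono_of_injective (hf.comp (Tuple.sort f).injective)
    · funext j
      simp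
  · intros; rfl

/-- Subtracting the next column from each column of a matrix whose last row is constant `1`. -/
theorem det_of_last_row_one {N : ℕ} (M : Matrix (Fin (N + 1)) (Fin (N + 1)) R)
    (hM : ∀ j, M (Fin.last N) j = 1) :
    det M = det (of fun i j : Fin N => M i.castSucc j.castSucc - M i.castSucc j.succ) := by
  set B : Matrix (Fin (N + 1)) (Fin (N + 1)) R := of fun i =>
    Fin.lastCases (M i (Fin.last N)) (fun j => M i j.castSucc - M i j.succ) with hB
  have h1 : det M = det B := by
    -- Reversing rows and columns preserves the determinant and turns the next column into the
    -- previous one, the form needed for the column operation.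
    rw [← det_submatrix_equiv_self Fin.revPerm M, ← det_submatrix_equiv_self Fin.revPerm B]
    refine det_eq_of_forall_col_eq_smul_add_pred (fun _ => 1) (fun i => ?_) (fun i j => ?_)
    · simp [hB]
    · simp [hB, Fin.rev_succ, Fin.rev_castSucc]
  have h2 : ∀ j : Fin N, B (Fin.last N) j.castSucc = 0 := fun j => by simp [hB, hM]
  rw [h1, det_succ_row B (Fin.last N), Fin.sum_univ_castSucc]
  simp only [h2, mul_zero, zero_mul, sum_const_zero, zero_add]
  have h3 : B (Fin.last N) (Fin.last N) = 1 := by simp [hB, hM]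
  rw [h3, ← two_mul, pow_mul]
  simp only [even_two, Even.neg_pow, one_pow, one_mul, Fin.succAbove_last]
  congr 1
  ext i j
  simp [hB]

/-- Subtracting the next column from each column but the last. -/
theorem det_sub_next_col {N : ℕ} (M : Fin N → Fin (N + 1) → R)
    (hM : ∀ i, M i (Fin.last N) = 0) :
    det (of fun i j : Fin N => M i j.castSucc) =
      det (of fun i j : Fin N => M i j.castSucc - M i j.succ) := by
  -- Border `M` by a row of ones. Expansion along the last column returns the left-hand side;
  -- `det_of_last_row_one` gives the right-hand side.
  set B : Matrix (Fin (N + 1)) (Fin (N + 1)) R :=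
    of (Fin.lastCases (fun _ => 1) M) with hB
  have h1 := det_of_last_row_one B (fun j => by simp [hB])
  have h2 : det B = det (of fun i j : Fin N => M i j.castSucc) := by
    rw [det_succ_column B (Fin.last N), Fin.sum_univ_castSucc]
    have h3 : ∀ j : Fin N, B j.castSucc (Fin.last N) = 0 := fun j => by simp [hB, hM]
    have h4 : B (Fin.last N) (Fin.last N) = 1 := by simp [hB]
    simp only [h3, mul_zero, zero_mul, sum_const_zero, zero_add]
    rw [h4, ← two_mul, pow_mul]
    simp only [even_two, Even.neg_pow, one_pow, one_mul, Fin.succAbove_last]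
    congr 1
    ext i j
    simp [hB]
  rw [← h2, h1]
  congr 1
  ext i j
  simp [hB]

/-- Expansion of a determinant whose columns are sums. -/
theorem det_sum_col {V : Type*} {N : ℕ} (t : Fin N → Finset V) (a : V → R)
    (c : Fin N → V → R) :
    det (of fun i j => ∑ v ∈ t j, a v * c i v) =
      ∑ f ∈ Fintype.piFinset t, (∏ j, a (f j)) * det (of fun i j => c i (f j)) := by
  simp only [det_apply', of_apply, mul_sum]
  rw [Finset.sum_comm]
  refine Finset.sum_congr rfl fun σ _ => ?_
  rw [prod_univ_sum, mul_sum]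
  refine Finset.sum_congr rfl fun f _ => ?_
  rw [prod_mul_distrib]
  ring

end Determinants

/-! ### Half-tableaux on one side of the diagonal, and peeling off their first layer -/

section HalfTableaux

variable {R : Type*} [CommRing R]

/-- Sums over functions on a disjoint union split into iterated sums. -/
theorem sum_fun_eq_sum_sum {α β γ V : Type*} [Fintype α] [Fintype β] [Fintype γ] [DecidableEq α]
    [DecidableEq β] [DecidableEq γ] [Fintype V] (e : α ⊕ β ≃ γ) (w : γ → V → R)
    (P : (γ → V) → Prop) [DecidablePred P] :
    (∑ T : γ → V, if P T then ∏ c, w c (T c) else 0) =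
      ∑ T₁ : α → V, ∑ T₂ : β → V, if P (Sum.elim T₁ T₂ ∘ e.symm) then
        (∏ a, w (e (Sum.inl a)) (T₁ a)) * ∏ b, w (e (Sum.inr b)) (T₂ b) else 0 := by
  rw [← Fintype.sum_prod_type']
  refine (Fintype.sum_equiv ((Equiv.sumArrowEquivProdArrow α β V).symm.trans
    (Equiv.arrowCongr e (Equiv.refl V))) _ _ fun T => ?_).symm
  have h : ((Equiv.sumArrowEquivProdArrow α β V).symm.trans
    (Equiv.arrowCongr e (Equiv.refl V))) T = Sum.elim T.1 T.2 ∘ e.symm := by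
    funext c
    simp [Equiv.arrowCongr, Equiv.sumArrowEquivProdArrow]
  rw [h]
  congr 1
  rw [← e.prod_comp, Fintype.prod_sum_type]
  simp

/-- The generating function of chains `v + ε ≤ v₀`, `v₀ + ε ≤ v₁`, … of length `p` in
`{0, …, n - 1}`, the `k`-th term being weighted by `x k`. -/
def chainSum (ε n : ℕ) : (ℕ → ℕ → R) → ℕ → ℕ → R
  | _, 0, _ => 1
  | x, p + 1, v => ∑ u ∈ Ico (v + ε) n, x 0 u * chainSum ε n (fun k => x (k + 1)) p u

/-- The boxes beyond the main diagonal: `p i` boxes in the row with index `i < N`. -/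
abbrev HalfBox (N : ℕ) (p : ℕ → ℕ) : Type := Σ i : Fin N, Fin (p i)

/-- The conditions on the entries `T` beyond the main diagonal `m`:
`ε = 0` describes the part to the right, `ε = 1` the part below. -/
def IsHalf (ε : ℕ) {N n : ℕ} (p : ℕ → ℕ) (m : Fin N → ℕ) (T : HalfBox N p → Fin n) : Prop :=
  (∀ (i : Fin N) (h : 0 < p i), m i + ε ≤ T ⟨i, 0, h⟩) ∧
  (∀ (i : Fin N) (k : ℕ) (h : k + 1 < p i),
    (T ⟨i, k, by lia⟩ : ℕ) + ε ≤ T ⟨i, k + 1, h⟩) ∧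
  (∀ (i j : Fin N) (h : 0 < p i), (j : ℕ) = i + 1 → (T ⟨i, 0, h⟩ : ℕ) < m j + ε) ∧
  (∀ (i j : Fin N) (k : ℕ) (h : k + 1 < p i) (h' : k < p j), (j : ℕ) = i + 1 →
    (T ⟨i, k + 1, h⟩ : ℕ) < T ⟨j, k, h'⟩ + ε)

/-- Splitting off the boxes next to the main diagonal. -/
noncomputable def halfBoxEquiv {N N' : ℕ} (p : ℕ → ℕ) (hN : N' ≤ N)
    (hpos : ∀ i < N', 0 < p i) (hzero : ∀ i, N' ≤ i → i < N → p i = 0) :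
    Fin N' ⊕ HalfBox N' (fun i => p i - 1) ≃ HalfBox N p :=
  Equiv.ofBijective
    (Sum.elim (fun i => ⟨i.castLE hN, 0, hpos i i.2⟩)
      (fun c => ⟨c.1.castLE hN, c.2 + 1, by have := c.2.2; simp only [Fin.val_castLE]; lia⟩))
    (by
      constructor
      · rintro (i | ⟨i, k⟩) (j | ⟨j, l⟩) h
        · simp only [Sum.elim_inl, Sigma.mk.injEq, Fin.castLE_inj] at h
          rw [h.1]
        · simp only [Sum.elim_inl, Sum.elim_inr, Sigma.mk.injEq, Fin.castLE_inj] at h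
          obtain ⟨rfl, h⟩ := h
          simp at h
        · simp only [Sum.elim_inl, Sum.elim_inr, Sigma.mk.injEq, Fin.castLE_inj] at h
          obtain ⟨rfl, h⟩ := h
          simp at h
        · simp only [Sum.elim_inr, Sigma.mk.injEq, Fin.castLE_inj] at h
          obtain ⟨rfl, h⟩ := h
          simp only [heq_eq_eq, Fin.mk.injEq, Nat.add_right_cancel_iff] at h
          rw [Fin.ext h]
      · rintro ⟨i, k, hk⟩
        have hi : (i : ℕ) < N' := by
          by_contra hc
          have := hzero i (by lia) i.2
          lia
        rcases k with _ | k
        · exact ⟨Sum.inl ⟨i, hi⟩, rfl⟩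
        · exact ⟨Sum.inr ⟨⟨i, hi⟩, ⟨k, by simp only; lia⟩⟩, rfl⟩)

theorem halfBoxEquiv_symm_zero {N N' : ℕ} (p : ℕ → ℕ) (hN : N' ≤ N)
    (hpos : ∀ i < N', 0 < p i) (hzero : ∀ i, N' ≤ i → i < N → p i = 0)
    (i : Fin N) (h : 0 < p i) (hi : (i : ℕ) < N') :
    (halfBoxEquiv p hN hpos hzero).symm ⟨i, 0, h⟩ = Sum.inl ⟨i, hi⟩ := by
  rw [Equiv.symm_apply_eq]
  rfl

theorem halfBoxEquiv_symm_succ {N N' : ℕ} (p : ℕ → ℕ) (hN : N' ≤ N)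
    (hpos : ∀ i < N', 0 < p i) (hzero : ∀ i, N' ≤ i → i < N → p i = 0)
    (i : Fin N) (k : ℕ) (h : k + 1 < p i) (hi : (i : ℕ) < N') :
    (halfBoxEquiv p hN hpos hzero).symm ⟨i, k + 1, h⟩ =
      Sum.inr ⟨⟨i, hi⟩, ⟨k, by simp only; lia⟩⟩ := by
  rw [Equiv.symm_apply_eq]
  rfl

/-- The induction step on shapes: once peeled off, the boxes next to the diagonal serve as the new
diagonal of a half-tableau with all lines one box shorter. -/
theorem isHalf_elim_iff (ε : ℕ) {N N' n : ℕ} (p : ℕ → ℕ) (hN : N' ≤ N)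
    (hpos : ∀ i < N', 0 < p i) (hzero : ∀ i, N' ≤ i → i < N → p i = 0)
    (m : Fin N → ℕ) (m' : Fin N' → Fin n) (T : HalfBox N' (fun i => p i - 1) → Fin n) :
    IsHalf ε p m (Sum.elim m' T ∘ (halfBoxEquiv p hN hpos hzero).symm) ↔
      ((∀ i : Fin N', m (i.castLE hN) + ε ≤ m' i) ∧
        ∀ (i : Fin N') (j : Fin N), (j : ℕ) = i + 1 → (m' i : ℕ) < m j + ε) ∧
      IsHalf ε (fun i => p i - 1) (fun i => (m' i : ℕ)) T := by
  have key : ∀ i : Fin N, 0 < p i → (i : ℕ) < N' := fun i h => by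
    by_contra hc
    have := hzero i (by lia) i.2
    lia
  have e0 : ∀ (i : Fin N) (h : 0 < p i),
      (Sum.elim m' T ∘ (halfBoxEquiv p hN hpos hzero).symm) ⟨i, 0, h⟩ = m' ⟨i, key i h⟩ :=
    fun i h => by
      rw [Function.comp_apply, halfBoxEquiv_symm_zero p hN hpos hzero i h (key i h), Sum.elim_inl]
  have e1 : ∀ (i : Fin N) (k : ℕ) (h : k + 1 < p i),
      (Sum.elim m' T ∘ (halfBoxEquiv p hN hpos hzero).symm) ⟨i, k + 1, h⟩ =
        T ⟨⟨i, key i (by lia)⟩, ⟨k, by simp only; lia⟩⟩ :=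
    fun i k h => by
      rw [Function.comp_apply, halfBoxEquiv_symm_succ p hN hpos hzero i k h (key i (by lia)),
        Sum.elim_inr]
  constructor
  · rintro ⟨h1, h2, h3, h4⟩
    refine ⟨⟨fun i => ?_, fun i j hij => ?_⟩, fun i h => ?_, fun i k h => ?_, fun i j h hij => ?_,
      fun i j k h h' hij => ?_⟩
    · have := h1 (i.castLE hN) (hpos i i.2)
      rwa [e0] at this
    · have := h3 (i.castLE hN) j (hpos i i.2) hij
      rwa [e0] at this
    · have := h2 (i.castLE hN) 0 (by simp only [Fin.val_castLE]; lia)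
      rwa [e0, e1] at this
    · have := h2 (i.castLE hN) (k + 1) (by simp only [Fin.val_castLE]; lia)
      rwa [e1, e1] at this
    · have := h4 (i.castLE hN) (j.castLE hN) 0 (by simp only [Fin.val_castLE]; lia)
        (hpos j j.2) hij
      rwa [e0, e1] at this
    · have := h4 (i.castLE hN) (j.castLE hN) (k + 1) (by simp only [Fin.val_castLE]; lia)
        (by simp only [Fin.val_castLE]; lia) hij
      rwa [e1, e1] at this
  · rintro ⟨⟨h0, h0'⟩, h1, h2, h3, h4⟩
    refine ⟨fun i h => ?_, fun i k h => ?_, fun i j h hij => ?_, fun i j k h h' hij => ?_⟩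
    · rw [e0]
      exact h0 ⟨i, key i h⟩
    · rcases k with _ | k
      · rw [e0, e1]
        exact h1 ⟨i, key i (by lia)⟩ (by simp only; lia)
      · rw [e1, e1]
        exact h2 ⟨i, key i (by lia)⟩ k (by simp only; lia)
    · rw [e0]
      exact h0' ⟨i, key i h⟩ j hij
    · rcases k with _ | k
      · rw [e0, e1]
        exact h3 ⟨i, key i (by lia)⟩ ⟨j, key j (by lia)⟩ (by simp only; lia) hij
      · rw [e1, e1]
        exact h4 ⟨i, key i (by lia)⟩ ⟨j, key j (by lia)⟩ k (by simp only; lia) (by simp only; lia)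
          hij

end HalfTableaux

end LacedSchur

namespace LacedSchur

open Finset Matrix

/-! ### Half-tableaux with given diagonal as a determinant -/

section HalfTableaux

variable {R : Type*} [CommRing R]

theorem chainSum_of_pos (ε n : ℕ) (x : ℕ → ℕ → R) {p : ℕ} (hp : 0 < p) (v : ℕ) :
    chainSum ε n x p v =
      ∑ u ∈ Ico (v + ε) n, x 0 u * chainSum ε n (fun k => x (k + 1)) (p - 1) u := by
  obtain ⟨q, rfl⟩ : ∃ q, p = q + 1 := ⟨p - 1, by lia⟩
  rfl

/-- After a column subtraction only first entries in an interval survive. With `a`, `b` consecutive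
diagonal entries, this interval encodes both conditions on a box next to the diagonal. -/
theorem chainSum_sub (ε n : ℕ) (x : ℕ → ℕ → R) {p : ℕ} (hp : 0 < p) {a b : ℕ} (hab : a ≤ b)
    (hb : b + ε ≤ n) :
    chainSum ε n x p a - chainSum ε n x p b =
      ∑ u ∈ Ico (a + ε) (b + ε), x 0 u * chainSum ε n (fun k => x (k + 1)) (p - 1) u := by
  rw [chainSum_of_pos ε n x hp, chainSum_of_pos ε n x hp, sub_eq_iff_eq_add,
    sum_Ico_consecutive _ (by lia) hb]

/-- The generating function of the parts of tableaux beyond a given main diagonal `m`. -/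
noncomputable def halfSum (ε n : ℕ) {N : ℕ} (x : ℕ → ℕ → R) (p : ℕ → ℕ) (m : Fin N → ℕ) : R :=
  open scoped Classical in
  ∑ T : HalfBox N p → Fin n, if IsHalf ε p m T then ∏ c, x c.2 (T c) else 0

/-- The upper bound for the entry next to the main diagonal. -/
def nextBound (ε n : ℕ) {N : ℕ} (m : Fin N → ℕ) (i : ℕ) : ℕ :=
  if h : i + 1 < N then m ⟨i + 1, h⟩ + ε else n

theorem sum_fun_fin_eq_sum_piFinset {N n : ℕ} (lo hi : Fin N → ℕ) (hn : ∀ i, hi i ≤ n)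
    (F : (Fin N → ℕ) → R) [DecidablePred fun m' : Fin N → Fin n =>
      ∀ i, lo i ≤ (m' i : ℕ) ∧ (m' i : ℕ) < hi i] :
    (∑ m' : Fin N → Fin n, if ∀ i, lo i ≤ (m' i : ℕ) ∧ (m' i : ℕ) < hi i then
        F (fun i => (m' i : ℕ)) else 0) =
      ∑ f ∈ Fintype.piFinset fun i => Ico (lo i) (hi i), F f := by
  rw [← sum_filter]
  refine sum_bij (fun m' _ i => (m' i : ℕ)) ?_ ?_ ?_ ?_
  · intro m' h
    simpa using h
  · intro a _ b _ h
    funext i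
    exact Fin.ext (congrFun h i)
  · intro f hf
    simp only [Fintype.mem_piFinset, mem_Ico] at hf
    refine ⟨fun i => ⟨f i, (hf i).2.trans_le (hn i)⟩, ?_, rfl⟩
    simpa using hf
  · intros; rfl

/-- Recursion for the tableau side: sum over the layer `f` next to the diagonal, which then becomes
the diagonal. `det_chainSum_eq_sum` is the same recursion for the determinant. -/
theorem halfSum_eq_sum (ε n : ℕ) {N N' : ℕ} (x : ℕ → ℕ → R) (p : ℕ → ℕ) (hN : N' ≤ N)
    (hpos : ∀ i < N', 0 < p i) (hzero : ∀ i, N' ≤ i → i < N → p i = 0)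
    (m : Fin N → ℕ) (hm : ∀ i, m i + ε ≤ n) :
    halfSum ε n x p m = ∑ f ∈ Fintype.piFinset fun i : Fin N' =>
        Ico (m (i.castLE hN) + ε) (nextBound ε n m i),
      (∏ j, x 0 (f j)) * halfSum ε n (fun k => x (k + 1)) (fun i => p i - 1) f := by
  classical
  have hb : ∀ i : ℕ, nextBound ε n m i ≤ n := fun i => by
    unfold nextBound
    split_ifs
    · exact hm _
    · exact le_rfl
  rw [← sum_fun_fin_eq_sum_piFinset _ _ (fun i => hb i)
    (fun f => (∏ j, x 0 (f j)) * halfSum ε n (fun k => x (k + 1)) (fun i => p i - 1) f)]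
  unfold halfSum
  rw [sum_fun_eq_sum_sum (halfBoxEquiv p hN hpos hzero) (fun c (v : Fin n) => x c.2 v)]
  refine Finset.sum_congr rfl fun m' _ => ?_
  have hcond : (∀ i : Fin N', m (i.castLE hN) + ε ≤ (m' i : ℕ) ∧
      (m' i : ℕ) < nextBound ε n m i) ↔
      ((∀ i : Fin N', m (i.castLE hN) + ε ≤ m' i) ∧
        ∀ (i : Fin N') (j : Fin N), (j : ℕ) = i + 1 → (m' i : ℕ) < m j + ε) := by
    constructor
    · intro h
      refine ⟨fun i => (h i).1, fun i j hij => ?_⟩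
      have := (h i).2
      have hlt : (i : ℕ) + 1 < N := hij ▸ j.2
      rw [nextBound, dif_pos hlt] at this
      have hj : j = ⟨i + 1, hlt⟩ := Fin.ext hij
      rwa [hj]
    · rintro ⟨h, h'⟩ i
      refine ⟨h i, ?_⟩
      unfold nextBound
      split_ifs with hlt
      · exact h' i ⟨i + 1, hlt⟩ rfl
      · exact (m' i).2
  simp only [isHalf_elim_iff, ← hcond]
  by_cases h : ∀ i : Fin N', m (i.castLE hN) + ε ≤ (m' i : ℕ) ∧ (m' i : ℕ) < nextBound ε n m i
  · simp only [if_pos h, mul_sum]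
    refine Finset.sum_congr rfl fun T _ => ?_
    by_cases hT : IsHalf ε (fun i => p i - 1) (fun i => (m' i : ℕ)) T
    · rw [if_pos ⟨h, hT⟩, if_pos hT]
      rfl
    · rw [if_neg (fun hc => hT hc.2), if_neg hT, mul_zero]
  · rw [if_neg h]
    exact Finset.sum_eq_zero fun T _ => if_neg fun hc => h hc.1

/-- Subtracting the next column leaves interval sums, and multilinearity in the columns expands
them. Since `N ≤ N' + 1`, at most the last line is empty, which gives the two cases. -/
theorem det_chainSum_eq_sum (ε n : ℕ) (hε : ε ≤ 1) {N N' : ℕ} (x : ℕ → ℕ → R) (p : ℕ → ℕ)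
    (hN : N' ≤ N) (hN' : N ≤ N' + 1)
    (hpos : ∀ i < N', 0 < p i) (hzero : ∀ i, N' ≤ i → i < N → p i = 0)
    (m : Fin N → ℕ) (hm : ∀ i, m i < n) (hmono : StrictMono m) :
    det (of fun i j : Fin N => chainSum ε n x (p i) (m j)) =
      ∑ f ∈ Fintype.piFinset fun i : Fin N' =>
          Ico (m (i.castLE hN) + ε) (nextBound ε n m i),
        (∏ j, x 0 (f j)) *
          det (of fun i j : Fin N' => chainSum ε n (fun k => x (k + 1)) (p i - 1) (f j)) := by
  rw [← det_sum_col]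
  rcases Nat.lt_or_ge N' N with hlt | hge
  · obtain rfl : N = N' + 1 := by lia
    -- The last line is empty, so its chain sums are all `1`: the determinant loses a row and a
    -- column.
    rw [det_of_last_row_one]
    · congr 1
      ext i j
      simp only [of_apply, Fin.val_castSucc]
      rw [chainSum_sub ε n x (hpos i i.2) (hmono (Fin.castSucc_lt_succ)).le
        (by have := hm j.succ; lia)]
      have : nextBound ε n m j = m j.succ + ε := by
        rw [nextBound, dif_pos (by lia)]
        rfl
      rw [this]
      rfl
    · intro j
      simp only [of_apply, Fin.val_last]
      rw [hzero N' le_rfl hlt]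
      rfl
  · obtain rfl : N = N' := by lia
    -- All lines are non-empty, so a fictitious diagonal entry `n` leaves no room for a first box
    -- and adds a zero column.
    set M : Fin (N + 1) → ℕ := Fin.snoc (α := fun _ => ℕ) m n with hM
    have h1 := det_sub_next_col (fun (i : Fin N) (j : Fin (N + 1)) => chainSum ε n x (p i) (M j))
      (fun i => by
        simp only [hM, Fin.snoc_last]
        rw [chainSum_of_pos ε n x (hpos i i.2), Ico_eq_empty (by lia), sum_empty])
    have h0 : ∀ j : Fin N, M j.castSucc = m j := fun j => by simp [hM]
    simp only [h0] at h1
    rw [h1]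
    congr 1
    ext i j
    simp only [of_apply, Fin.castLE_rfl, id]
    by_cases hj : (j : ℕ) + 1 < N
    · have e1 : M j.succ = m ⟨j + 1, hj⟩ := h0 ⟨j + 1, hj⟩
      have e2 : nextBound ε n m j = m ⟨j + 1, hj⟩ + ε := by rw [nextBound, dif_pos hj]
      rw [e1, e2, chainSum_sub ε n x (hpos i i.2) (hmono (by simp [Fin.lt_def])).le
        (by have := hm ⟨j + 1, hj⟩; lia)]
    · have e1 : M j.succ = n := by
        have : j.succ = Fin.last N := Fin.ext (by simp; lia)
        rw [this, hM, Fin.snoc_last]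
      have e2 : nextBound ε n m j = n := by rw [nextBound, dif_neg hj]
      rw [e1, e2, chainSum_of_pos ε n x (hpos i i.2), chainSum_of_pos ε n x (hpos i i.2),
        Ico_eq_empty (a := n + ε) (by lia), sum_empty, sub_zero]

/-- The parts of tableaux beyond a given main diagonal are enumerated by a determinant. -/
theorem det_chainSum_eq_halfSum (ε n : ℕ) (hε : ε ≤ 1) (K : ℕ) :
    ∀ (N : ℕ) (x : ℕ → ℕ → R) (p : ℕ → ℕ) (m : Fin N → ℕ),
      (∀ i j, i < j → j < N → p j < p i) → (∀ i < N, p i < K) → StrictMono m →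
      (∀ i, m i < n) →
      det (of fun i j : Fin N => chainSum ε n x (p i) (m j)) = halfSum ε n x p m := by
  have h0 : ∀ (x : ℕ → ℕ → R) (p : ℕ → ℕ) (m : Fin 0 → ℕ),
      det (of fun i j : Fin 0 => chainSum ε n x (p i) (m j)) = halfSum ε n x p m := by
    intro x p m
    rw [det_isEmpty, halfSum, Fintype.sum_unique, if_pos, Fintype.prod_empty]
    exact ⟨fun i => i.elim0, fun i => i.elim0, fun i => i.elim0, fun i => i.elim0⟩
  induction K with
  | zero =>
    intro N x p m _ hK _ _
    rcases Nat.eq_zero_or_pos N with rfl | hN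
    · exact h0 x p m
    · exact absurd (hK 0 hN) (by lia)
  | succ K ih =>
    intro N x p m hp hK hmono hm
    rcases N with _ | N₁
    · exact h0 x p m
    -- The lengths decrease strictly, so only the last can be zero.
    obtain ⟨N', hN, hN', hpos, hzero⟩ : ∃ N', N' ≤ N₁ + 1 ∧ N₁ + 1 ≤ N' + 1 ∧
        (∀ i < N', 0 < p i) ∧ (∀ i, N' ≤ i → i < N₁ + 1 → p i = 0) := by
      rcases Nat.eq_zero_or_pos (p N₁) with h | h
      · refine ⟨N₁, by lia, le_rfl, fun i hi => ?_, fun i hi hi' => ?_⟩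
        · have := hp i N₁ hi (by lia)
          lia
        · obtain rfl : i = N₁ := by lia
          exact h
      · refine ⟨N₁ + 1, le_rfl, by lia, fun i hi => ?_, fun i hi hi' => by lia⟩
        rcases Nat.lt_or_ge i N₁ with hlt | hge
        · have := hp i N₁ hlt (by lia)
          lia
        · obtain rfl : i = N₁ := by lia
          exact h
    rw [det_chainSum_eq_sum ε n hε x p hN hN' hpos hzero m hm hmono,
      halfSum_eq_sum ε n x p hN hpos hzero m (fun i => by have := hm i; lia)]
    refine Finset.sum_congr rfl fun f hf => ?_
    simp only [Fintype.mem_piFinset, mem_Ico] at hf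
    congr 1
    refine ih N' (fun k => x (k + 1)) (fun i => p i - 1) f ?_ ?_ ?_ ?_
    · intro i j hij hj
      have := hp i j hij (by lia)
      have := hpos j hj
      lia
    · intro i hi
      have := hK i (by lia)
      have := hpos i hi
      lia
    -- Consecutive intervals abut, so the new diagonal again increases strictly.
    · rcases N' with _ | N''
      · exact fun i => i.elim0
      refine Fin.strictMono_iff_lt_succ.2 fun i => ?_
      have h1 := (hf i.castSucc).2
      have h2 := (hf i.succ).1
      rw [nextBound, dif_pos (by simp only [Fin.val_castSucc]; lia)] at h1
      exact h1.trans_le h2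
    · intro i
      refine (hf i).2.trans_le ?_
      unfold nextBound
      split_ifs
      · have := hm ⟨i + 1, ‹_›⟩
        lia
      · exact le_rfl

end HalfTableaux

end LacedSchur

namespace LacedSchur

open Finset Matrix

/-! ### The Giambelli formula for truncated tableaux with content weights -/

section Truncation

variable {R : Type*} [CommRing R]

/-- Sums over functions on a disjoint union of three types split into iterated sums. -/
theorem sum_fun_eq_sum_sum_sum {α β γ δ V : Type*} [Fintype α] [Fintype β] [Fintype γ] [Fintype δ]
    [DecidableEq α] [DecidableEq β] [DecidableEq γ] [DecidableEq δ] [Fintype V]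
    (e : α ⊕ (β ⊕ γ) ≃ δ) (w : δ → V → R)
    (P : (δ → V) → Prop) [DecidablePred P] :
    (∑ T : δ → V, if P T then ∏ c, w c (T c) else 0) =
      ∑ T₁ : α → V, ∑ T₂ : β → V, ∑ T₃ : γ → V,
        if P (Sum.elim T₁ (Sum.elim T₂ T₃) ∘ e.symm) then
          (∏ a, w (e (Sum.inl a)) (T₁ a)) * ((∏ b, w (e (Sum.inr (Sum.inl b))) (T₂ b)) *
            ∏ c, w (e (Sum.inr (Sum.inr c))) (T₃ c)) else 0 := by
  rw [sum_fun_eq_sum_sum e w P]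
  refine Finset.sum_congr rfl fun T₁ _ => ?_
  rw [← Fintype.sum_prod_type']
  refine (Fintype.sum_equiv (Equiv.sumArrowEquivProdArrow β γ V).symm _ _ fun T => ?_).symm
  rw [Fintype.prod_sum_type]
  rfl

/-- Semi-standard tableaux with entries in `Fin n`. -/
def IsFinSSYT (D : Finset Box) {n : ℕ} (T : D → Fin n) : Prop :=
  (∀ a b : D, a.1.1 = b.1.1 → a.1.2 < b.1.2 → T a ≤ T b) ∧
  (∀ a b : D, a.1.2 = b.1.2 → a.1.1 < b.1.1 → T a < T b)

/-- The generating function of the tableaux of shape `D` with entries in `Fin n`. -/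
noncomputable def truncSum (n : ℕ) (D : Finset Box) (w : Box → ℕ → R) : R :=
  open scoped Classical in
  ∑ T : D → Fin n, if IsFinSSYT D T then ∏ c : D, w c.1 (T c) else 0

theorem truncSum_congr {n : ℕ} {D : Finset Box} {w w' : Box → ℕ → R}
    (h : ∀ c ∈ D, ∀ v, w c v = w' c v) : truncSum n D w = truncSum n D w' := by
  unfold truncSum
  refine Finset.sum_congr rfl fun T _ => ?_
  rw [Finset.prod_congr rfl fun c _ => h c.1 c.2 _]

/-- The box with natural coordinates `r` and `c`. -/
def natBox (r c : ℕ) : Box := ((r : ℤ), (c : ℤ))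

theorem natBox_inj {r c r' c' : ℕ} : natBox r c = natBox r' c' ↔ r = r' ∧ c = c' := by
  simp [natBox]

/-- `D` is the Young diagram with Frobenius coordinates `p 0, …, p (N - 1)` and
`q 0, …, q (N - 1)`. -/
structure IsFrobenius (D : Finset Box) (N : ℕ) (p q : ℕ → ℕ) : Prop where
  anti_p : ∀ i j, i < j → j < N → p j < p i
  anti_q : ∀ i j, i < j → j < N → q j < q i
  exists_natBox : ∀ b ∈ D, ∃ r c, b = natBox r c
  mem_iff : ∀ r c, natBox r c ∈ D ↔
    r ≤ c ∧ r < N ∧ c ≤ r + p r ∨ c ≤ r ∧ c < N ∧ r ≤ c + q c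

/-- Rephrases that `p i + i` decreases weakly, that is, that the lines of the diagram do not reach
further as the index grows. -/
theorem add_index_le_of_anti {N : ℕ} {p : ℕ → ℕ} (hp : ∀ i j, i < j → j < N → p j < p i) {i j : ℕ}
    (hij : i ≤ j) (hj : j < N) : p j + j ≤ p i + i := by
  induction j, hij using Nat.le_induction with
  | base => exact le_rfl
  | succ k hk ih =>
    have := hp k (k + 1) (by lia) hj
    have := ih (by lia)
    lia

namespace IsFrobenius

variable {D : Finset Box} {N : ℕ} {p q : ℕ → ℕ}

theorem natBox_mem_of_le_col (hD : IsFrobenius D N p q) {r c c' : ℕ} (h : natBox r c' ∈ D)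
    (hc : c ≤ c') : natBox r c ∈ D := by
  rw [hD.mem_iff] at h ⊢
  rcases Nat.lt_or_ge c r with hcr | hcr
  · right
    rcases h with h | h
    · have := add_index_le_of_anti hD.anti_q hcr.le h.2.1
      exact ⟨hcr.le, by lia, by lia⟩
    · have := add_index_le_of_anti hD.anti_q hc h.2.1
      exact ⟨hcr.le, by lia, by lia⟩
  · left
    rcases h with h | h
    · exact ⟨hcr, by lia, by lia⟩
    · exact ⟨hcr, by lia, by lia⟩

theorem natBox_mem_of_le_row (hD : IsFrobenius D N p q) {r r' c : ℕ} (h : natBox r' c ∈ D)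
    (hr : r ≤ r') : natBox r c ∈ D := by
  rw [hD.mem_iff] at h ⊢
  rcases Nat.lt_or_ge r c with hcr | hcr
  · left
    rcases h with h | h
    · have := add_index_le_of_anti hD.anti_p hr h.2.1
      exact ⟨hcr.le, by lia, by lia⟩
    · have := add_index_le_of_anti hD.anti_p hcr.le h.2.1
      exact ⟨hcr.le, by lia, by lia⟩
  · right
    rcases h with h | h
    · exact ⟨hcr, by lia, by lia⟩
    · exact ⟨hcr, by lia, by lia⟩

/-- It suffices to compare neighbouring entries. -/
theorem isFinSSYT_of_adjacent (hD : IsFrobenius D N p q) {n : ℕ} {T : D → Fin n}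
    (hrow : ∀ (r c : ℕ) (h : natBox r c ∈ D) (h' : natBox r (c + 1) ∈ D), T ⟨_, h⟩ ≤ T ⟨_, h'⟩)
    (hcol : ∀ (r c : ℕ) (h : natBox r c ∈ D) (h' : natBox (r + 1) c ∈ D), T ⟨_, h⟩ < T ⟨_, h'⟩) :
    IsFinSSYT D T := by
  have hrow' : ∀ (r c c' : ℕ) (h : natBox r c ∈ D), c ≤ c' → ∀ h' : natBox r c' ∈ D,
      T ⟨_, h⟩ ≤ T ⟨_, h'⟩ := by
    intro r c c' h hc
    induction c', hc using Nat.le_induction with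
    | base => exact fun _ => le_rfl
    | succ k hk ih =>
      intro h'
      exact (ih (hD.natBox_mem_of_le_col h' (by lia))).trans (hrow _ _ _ h')
  have hcol' : ∀ (r r' c : ℕ) (h : natBox r c ∈ D), r < r' → ∀ h' : natBox r' c ∈ D,
      T ⟨_, h⟩ < T ⟨_, h'⟩ := by
    intro r r' c h hr
    induction r', hr using Nat.le_induction with
    | base => exact fun h' => hcol _ _ h h'
    | succ k hk ih =>
      intro h'
      exact (ih (hD.natBox_mem_of_le_row h' (by lia))).trans (hcol _ _ _ h')
  constructor
  · rintro ⟨a, ha⟩ ⟨b, hb⟩ h1 h2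
    obtain ⟨r, c, rfl⟩ := hD.exists_natBox a ha
    obtain ⟨r', c', rfl⟩ := hD.exists_natBox b hb
    simp only [natBox, Nat.cast_inj, Nat.cast_lt] at h1 h2
    subst h1
    exact hrow' _ _ _ _ h2.le _
  · rintro ⟨a, ha⟩ ⟨b, hb⟩ h1 h2
    obtain ⟨r, c, rfl⟩ := hD.exists_natBox a ha
    obtain ⟨r', c', rfl⟩ := hD.exists_natBox b hb
    simp only [natBox, Nat.cast_inj, Nat.cast_lt] at h1 h2
    subst h1
    exact hcol' _ _ _ _ h2 _

theorem diag_mem (hD : IsFrobenius D N p q) (i : Fin N) : natBox i i ∈ D :=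
  (hD.mem_iff _ _).2 (Or.inl ⟨le_rfl, i.2, by lia⟩)

theorem right_mem (hD : IsFrobenius D N p q) (c : HalfBox N p) :
    natBox c.1 (c.1 + (c.2 + 1)) ∈ D :=
  (hD.mem_iff _ _).2 (Or.inl ⟨by lia, c.1.2, by have := c.2.2; lia⟩)

theorem below_mem (hD : IsFrobenius D N p q) (c : HalfBox N q) :
    natBox (c.1 + (c.2 + 1)) c.1 ∈ D :=
  (hD.mem_iff _ _).2 (Or.inr ⟨by lia, c.1.2, by have := c.2.2; lia⟩)

/-- The decomposition of a diagram into the main diagonal and the parts beyond it. -/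
noncomputable def boxEquiv (hD : IsFrobenius D N p q) :
    Fin N ⊕ (HalfBox N p ⊕ HalfBox N q) ≃ D :=
  Equiv.ofBijective
    (Sum.elim (fun i => ⟨natBox i i, hD.diag_mem i⟩)
      (Sum.elim (fun c => ⟨natBox c.1 (c.1 + (c.2 + 1)), hD.right_mem c⟩)
        (fun c => ⟨natBox (c.1 + (c.2 + 1)) c.1, hD.below_mem c⟩)))
    (by
      have hsig : ∀ {p : ℕ → ℕ} (a b : HalfBox N p), (a.1 : ℕ) = b.1 → (a.2 : ℕ) = b.2 →
          a = b := by
        rintro p ⟨i, k⟩ ⟨j, l⟩ h1 h2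
        obtain rfl : i = j := Fin.ext h1
        obtain rfl : k = l := Fin.ext h2
        rfl
      constructor
      · rintro (a | a | a) (b | b | b) h <;>
          simp only [Sum.elim_inl, Sum.elim_inr, Subtype.mk.injEq, natBox_inj] at h
        · rw [Fin.ext h.1]
        · lia
        · lia
        · lia
        · rw [hsig a b h.1 (by lia)]
        · lia
        · lia
        · lia
        · rw [hsig a b h.2 (by lia)]
      · rintro ⟨b, hb⟩
        obtain ⟨r, c, rfl⟩ := hD.exists_natBox b hb
        rcases Nat.lt_trichotomy r c with h | h | h
        · obtain ⟨k, rfl⟩ : ∃ k, c = r + (k + 1) := ⟨c - r - 1, by lia⟩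
          have := (hD.mem_iff _ _).1 hb
          exact ⟨Sum.inr (Sum.inl ⟨⟨r, by lia⟩, ⟨k, by simp only; lia⟩⟩), rfl⟩
        · subst h
          have := (hD.mem_iff _ _).1 hb
          exact ⟨Sum.inl ⟨r, by lia⟩, rfl⟩
        · obtain ⟨k, rfl⟩ : ∃ k, r = c + (k + 1) := ⟨r - c - 1, by lia⟩
          have := (hD.mem_iff _ _).1 hb
          exact ⟨Sum.inr (Sum.inr ⟨⟨c, by lia⟩, ⟨k, by simp only; lia⟩⟩), rfl⟩)

/-- No box strictly right of the diagonal is adjacent to one strictly below it, so the conditions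
separate. The right part is weak along its lines and strict between them; below it is the reverse.
This is why `ε` enters both kinds of inequality: `< · + 1` is the weak relation. -/
theorem isFinSSYT_iff (hD : IsFrobenius D N p q) {n : ℕ} (T : D → Fin n) :
    IsFinSSYT D T ↔
      IsHalf 0 p (fun i => (T (hD.boxEquiv (Sum.inl i)) : ℕ))
          (fun c => T (hD.boxEquiv (Sum.inr (Sum.inl c)))) ∧
        IsHalf 1 q (fun i => (T (hD.boxEquiv (Sum.inl i)) : ℕ))
          (fun c => T (hD.boxEquiv (Sum.inr (Sum.inr c)))) := by
  constructor
  · rintro ⟨hrow, hcol⟩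
    have hr : ∀ (a b : Box) (ha : a ∈ D) (hb : b ∈ D), a.1 = b.1 → a.2 < b.2 →
        (T ⟨a, ha⟩ : ℕ) ≤ T ⟨b, hb⟩ := fun a b ha hb h1 h2 => hrow ⟨a, ha⟩ ⟨b, hb⟩ h1 h2
    have hc : ∀ (a b : Box) (ha : a ∈ D) (hb : b ∈ D), a.2 = b.2 → a.1 < b.1 →
        (T ⟨a, ha⟩ : ℕ) < T ⟨b, hb⟩ := fun a b ha hb h1 h2 => hcol ⟨a, ha⟩ ⟨b, hb⟩ h1 h2
    refine ⟨⟨fun i h => ?_, fun i k h => ?_, fun i j h hij => ?_, fun i j k h h' hij => ?_⟩,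
      ⟨fun i h => ?_, fun i k h => ?_, fun i j h hij => ?_, fun i j k h h' hij => ?_⟩⟩
    · exact hr _ _ _ _ rfl (by simp [natBox])
    · exact hr _ _ _ _ rfl (by simp [natBox])
    · exact hc _ _ _ _ (by simp [natBox, hij]) (by simp [natBox, hij])
    · exact hc _ _ _ _ (by simp [natBox, hij]; ring) (by simp [natBox, hij])
    · exact hc _ _ _ _ rfl (by simp [natBox])
    · exact hc _ _ _ _ rfl (by simp [natBox])
    · exact Nat.lt_succ_of_le (hr _ _ _ _ (by simp [natBox, hij]) (by simp [natBox, hij]))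
    · exact Nat.lt_succ_of_le
        (hr _ _ _ _ (by simp [natBox, hij]; ring) (by simp [natBox, hij]))
  · rintro ⟨⟨r1, r2, r3, r4⟩, l1, l2, l3, l4⟩
    have congrT : ∀ (a b : Box) (ha : a ∈ D) (hb : b ∈ D), a = b → T ⟨a, ha⟩ = T ⟨b, hb⟩ := by
      rintro a b ha hb rfl
      rfl
    refine hD.isFinSSYT_of_adjacent (fun r c h h' => ?_) (fun r c h h' => ?_)
    · have m1 := (hD.mem_iff _ _).1 h
      have m2 := (hD.mem_iff _ _).1 h'
      rcases Nat.lt_or_ge c r with hlt | hge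
      · obtain ⟨k, rfl⟩ : ∃ k, r = c + (k + 1) := ⟨r - c - 1, by lia⟩
        rcases k with _ | k
        · have := l3 ⟨c, by lia⟩ ⟨c + 1, by lia⟩ (by simp only; lia) rfl
          exact Nat.le_of_lt_succ this
        · have := l4 ⟨c, by lia⟩ ⟨c + 1, by lia⟩ k (by simp only; lia) (by simp only; lia) rfl
          rw [congrT _ (natBox (c + 1 + (k + 1)) (c + 1)) h'
            (hD.below_mem ⟨⟨c + 1, by lia⟩, ⟨k, by simp only; lia⟩⟩) (by rw [natBox_inj]; lia)]
          exact Nat.le_of_lt_succ this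
      · obtain ⟨k, rfl⟩ : ∃ k, c = r + k := ⟨c - r, by lia⟩
        rcases k with _ | k
        · exact r1 ⟨r, by lia⟩ (by simp only; lia)
        · exact r2 ⟨r, by lia⟩ k (by simp only; lia)
    · have m1 := (hD.mem_iff _ _).1 h
      have m2 := (hD.mem_iff _ _).1 h'
      rcases Nat.lt_or_ge r c with hlt | hge
      · obtain ⟨k, rfl⟩ : ∃ k, c = r + (k + 1) := ⟨c - r - 1, by lia⟩
        rcases k with _ | k
        · exact r3 ⟨r, by lia⟩ ⟨r + 1, by lia⟩ (by simp only; lia) rfl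
        · have := r4 ⟨r, by lia⟩ ⟨r + 1, by lia⟩ k (by simp only; lia) (by simp only; lia) rfl
          rw [congrT _ (natBox (r + 1) (r + 1 + (k + 1))) h'
            (hD.right_mem ⟨⟨r + 1, by lia⟩, ⟨k, by simp only; lia⟩⟩) (by rw [natBox_inj]; lia)]
          exact this
      · obtain ⟨k, rfl⟩ : ∃ k, r = c + k := ⟨r - c, by lia⟩
        rcases k with _ | k
        · exact l1 ⟨c, by lia⟩ (by simp only; lia)
        · exact l2 ⟨c, by lia⟩ k (by simp only; lia)

/-- Every diagonal box but the last has a right neighbour, whose entry lies weakly above the `i`-th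
diagonal entry and strictly below the next one. -/
theorem strictMono_of_isHalf_zero {n : ℕ} (hp : ∀ i j, i < j → j < N → p j < p i)
    {m : Fin N → ℕ} {T : HalfBox N p → Fin n} (h : IsHalf 0 p m T) : StrictMono m := by
  rcases N with _ | N
  · exact fun i => i.elim0
  refine Fin.strictMono_iff_lt_succ.2 fun i => ?_
  have hi : 0 < p i.castSucc := by
    have := hp i (i + 1) (by lia) (by lia)
    simp only [Fin.val_castSucc]
    lia
  have h1 := h.1 i.castSucc hi
  have h3 := h.2.2.1 i.castSucc i.succ hi (by simp)
  lia

theorem truncSum_eq_sum_halfSum (hD : IsFrobenius D N p q) (n : ℕ) (w : Box → ℕ → R)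
    (x : ℤ → ℕ → R) (hw : ∀ c ∈ D, ∀ v, w c v = x (c.2 - c.1) v) :
    truncSum n D w = ∑ m : Fin N → Fin n, (∏ i, x 0 (m i)) *
      (halfSum 0 n (fun k => x ((k : ℤ) + 1)) p (fun i => (m i : ℕ)) *
        halfSum 1 n (fun k => x (-((k : ℤ) + 1))) q (fun i => (m i : ℕ))) := by
  classical
  unfold truncSum halfSum
  rw [sum_fun_eq_sum_sum_sum hD.boxEquiv (fun c (v : Fin n) => w c.1 v)]
  refine Finset.sum_congr rfl fun m _ => ?_
  rw [sum_mul_sum, mul_sum]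
  refine Finset.sum_congr rfl fun T₁ _ => ?_
  rw [mul_sum]
  refine Finset.sum_congr rfl fun T₂ _ => ?_
  have hiff : IsFinSSYT D (Sum.elim m (Sum.elim T₁ T₂) ∘ hD.boxEquiv.symm) ↔
      IsHalf 0 p (fun i => (m i : ℕ)) T₁ ∧ IsHalf 1 q (fun i => (m i : ℕ)) T₂ := by
    rw [hD.isFinSSYT_iff]
    simp only [Function.comp_apply, Equiv.symm_apply_apply, Sum.elim_inl, Sum.elim_inr]
  rw [if_congr hiff rfl rfl]
  have e0 : ∏ i, w (hD.boxEquiv (Sum.inl i)).1 (m i) = ∏ i, x 0 (m i) :=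
    Finset.prod_congr rfl fun i _ => by
      rw [hw _ (hD.boxEquiv (Sum.inl i)).2]
      congr 1
      simp [boxEquiv, natBox]
  have e1 : ∏ c, w (hD.boxEquiv (Sum.inr (Sum.inl c))).1 (T₁ c) =
      ∏ c, x ((c.2 : ℕ) + 1) (T₁ c) :=
    Finset.prod_congr rfl fun c _ => by
      rw [hw _ (hD.boxEquiv (Sum.inr (Sum.inl c))).2]
      congr 1
      simp [boxEquiv, natBox]
  have e2 : ∏ c, w (hD.boxEquiv (Sum.inr (Sum.inr c))).1 (T₂ c) =
      ∏ c, x (-((c.2 : ℕ) + 1)) (T₂ c) :=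
    Finset.prod_congr rfl fun c _ => by
      rw [hw _ (hD.boxEquiv (Sum.inr (Sum.inr c))).2]
      congr 1
      simp [boxEquiv, natBox]
  rw [e0, e1, e2]
  by_cases h1 : IsHalf 0 p (fun i => (m i : ℕ)) T₁ <;>
    by_cases h2 : IsHalf 1 q (fun i => (m i : ℕ)) T₂ <;> simp [h1, h2]

/-- The generating function of tableaux whose weights depend only on contents. -/
theorem truncSum_eq_det (hD : IsFrobenius D N p q) (n : ℕ) (w : Box → ℕ → R)
    (x : ℤ → ℕ → R) (hw : ∀ c ∈ D, ∀ v, w c v = x (c.2 - c.1) v) :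
    truncSum n D w = det (of fun i j : Fin N => ∑ v : Fin n,
      chainSum 0 n (fun k => x ((k : ℤ) + 1)) (p i) v *
        (x 0 v * chainSum 1 n (fun k => x (-((k : ℤ) + 1))) (q j) v)) := by
  classical
  rw [det_sum_mul (fun (i : Fin N) (v : Fin n) => chainSum 0 n (fun k => x ((k : ℤ) + 1)) (p i) v)
    (fun (j : Fin N) (v : Fin n) => x 0 v * chainSum 1 n (fun k => x (-((k : ℤ) + 1))) (q j) v),
    hD.truncSum_eq_sum_halfSum n w x hw, sum_filter]
  refine Finset.sum_congr rfl fun m _ => ?_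
  split_ifs with hm
  · have hbound : ∀ {p : ℕ → ℕ}, ∃ K, ∀ i < N, p i < K := fun {p} =>
      ⟨∑ i ∈ range N, p i + 1, fun i hi => Nat.lt_succ_of_le
        (single_le_sum (f := p) (fun _ _ => Nat.zero_le _) (mem_range.2 hi))⟩
    obtain ⟨K, hK⟩ := hbound (p := p)
    obtain ⟨K', hK'⟩ := hbound (p := q)
    have hm' : StrictMono fun i => (m i : ℕ) := hm
    rw [← det_chainSum_eq_halfSum 0 n (by lia) K N _ p _ hD.anti_p hK hm' fun i => (m i).2,
      ← det_chainSum_eq_halfSum 1 n le_rfl K' N _ q _ hD.anti_q hK' hm' fun i => (m i).2]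
    -- The diagonal weights are put into the columns of the second factor, so that each is counted
    -- once.
    have := det_mul_row (fun k : Fin N => x 0 (m k))
      (of fun j k : Fin N => chainSum 1 n (fun k => x (-((k : ℤ) + 1))) (q j) (m k))
    simp only [of_apply] at this
    rw [this]
    ring
  -- Diagonals that do not increase strictly carry no tableaux, in accordance with the range of the
  -- Cauchy–Binet sum.
  · have : halfSum 0 n (fun k => x ((k : ℤ) + 1)) p (fun i => (m i : ℕ)) = 0 := by
      unfold halfSum
      refine Finset.sum_eq_zero fun T _ => if_neg fun hc => hm ?_
      exact strictMono_of_isHalf_zero hD.anti_p hc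
    rw [this]
    ring

end IsFrobenius

theorem isFrobenius_hook (p q : ℕ) : IsFrobenius (hook p q) 1 (fun _ => p) (fun _ => q) where
  anti_p i j hij hj := by lia
  anti_q i j hij hj := by lia
  exists_natBox b hb := by
    simp only [hook, mem_union, mem_image] at hb
    rcases hb with ⟨k, _, rfl⟩ | ⟨k, _, rfl⟩
    · exact ⟨0, k, rfl⟩
    · exact ⟨k, 0, rfl⟩
  mem_iff r c := by
    simp only [hook, mem_union, mem_image, natBox, mem_range, Prod.mk.injEq, Nat.cast_inj]
    constructor
    · rintro (⟨k, hk, h1, rfl⟩ | ⟨k, hk, rfl, h1⟩) <;> lia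
    · rintro (⟨h1, h2, h3⟩ | ⟨h1, h2, h3⟩)
      · exact Or.inl ⟨c, by lia, by lia, rfl⟩
      · exact Or.inr ⟨r, by lia, rfl, by lia⟩

/-- The Giambelli formula for tableaux with entries in `Fin n` whose weights depend only on
contents. -/
theorem truncSum_eq_det_hook {D : Finset Box} {N : ℕ} {p q : ℕ → ℕ} (hD : IsFrobenius D N p q)
    (n : ℕ) (x : ℤ → ℕ → R) :
    truncSum n D (fun c => x (c.2 - c.1)) =
      det (of fun i j : Fin N => truncSum n (hook (p i) (q j)) (fun c => x (c.2 - c.1))) := by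
  rw [hD.truncSum_eq_det n _ x fun _ _ _ => rfl]
  congr 1
  ext i j
  simp only [of_apply]
  -- A hook has a single diagonal box, so the same formula makes its sum a one-by-one determinant,
  -- namely the matrix entry.
  rw [(isFrobenius_hook (p i) (q j)).truncSum_eq_det n _ x fun _ _ _ => rfl]
  simp

end Truncation

end LacedSchur

namespace LacedSchur

open Finset Filter Topology

/-! ### Absolute convergence, continuity and truncation of the series -/

section Convergence

/-- Each entry of a tableau is bounded by an entry in a corner. -/
theorem exists_corner_le {D : Finset Box} (M : SSYT D) (c : D) :
    ∃ b : D, b.1 ∈ corners D ∧ M.1 c ≤ M.1 b := by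
  -- Among the boxes with entry at least that of `c`, take one with maximal row plus column; a right
  -- or lower neighbour would contradict maximality.
  obtain ⟨b, hb, hmax⟩ := exists_max_image (univ.filter fun b : D => M.1 c ≤ M.1 b)
    (fun b => b.1.1 + b.1.2) ⟨c, by simp⟩
  simp only [mem_filter, mem_univ, true_and] at hb hmax
  refine ⟨b, ?_, hb⟩
  simp only [corners, mem_filter, b.2, true_and]
  constructor
  · intro h
    have := hmax ⟨_, h⟩ (hb.trans (M.2.1 b ⟨_, h⟩ rfl (by simp)))
    simp only at this
    lia
  · intro h
    have := hmax ⟨_, h⟩ (hb.trans (M.2.2 b ⟨_, h⟩ rfl (by simp)).le)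
    simp only at this
    lia

theorem norm_weight (D : Finset Box) (s : Box → ℂ) (M : SSYT D) :
    ‖weight D s M‖ = ∏ c : D, ((M.1 c : ℕ) : ℝ) ^ (-(s c.1).re) := by
  rw [weight, norm_prod]
  refine Finset.prod_congr rfl fun c _ => ?_
  rw [norm_div, norm_one, Complex.norm_natCast_cpow_of_pos (M.1 c).pos,
    Real.rpow_neg (Nat.cast_nonneg _), one_div]

/-- Let `P` be the product of the corner entries; it dominates every entry. Raising the exponent at
a non-corner from `1` to `1 + δ` costs at most `P ^ δ`, and there are at most `#D` non-corners. The
surplus `#D * δ` at each corner supplies `P ^ (-(#D * δ))`, which pays for all of them. -/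
theorem norm_weight_le {D : Finset Box} {s : Box → ℂ} {δ : ℝ} (hδ : 0 ≤ δ)
    (h₁ : ∀ c ∈ D, 1 ≤ (s c).re) (h₂ : ∀ c ∈ corners D, 1 + (#D + 1) * δ ≤ (s c).re)
    (M : SSYT D) :
    ‖weight D s M‖ ≤ ∏ c : D, ((M.1 c : ℕ) : ℝ) ^ (-(1 + δ)) := by
  rw [norm_weight]
  set a : D → ℝ := fun c => ((M.1 c : ℕ) : ℝ) with ha
  have ha1 : ∀ c, 1 ≤ a c := fun c => by
    simp only [ha]
    exact_mod_cast (M.1 c).pos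
  have ha0 : ∀ c, 0 < a c := fun c => one_pos.trans_le (ha1 c)
  set P : ℝ := ∏ c : D with c.1 ∈ corners D, a c with hP
  have hP1 : 1 ≤ P := Finset.one_le_prod fun c _ => ha1 c
  have hP0 : 0 < P := one_pos.trans_le hP1
  have haP : ∀ c, a c ≤ P := fun c => by
    obtain ⟨b, hb, hle⟩ := exists_corner_le M c
    refine le_trans (show a c ≤ a b from ?_) ?_
    · simp only [ha]
      exact_mod_cast hle
    · rw [hP, ← mul_prod_erase (univ.filter fun c : D => c.1 ∈ corners D) a
        (mem_filter.2 ⟨mem_univ b, hb⟩)]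
      exact le_mul_of_one_le_right (ha0 b).le (Finset.one_le_prod fun c _ => ha1 c)
  have hterm : ∀ c : D, a c ^ (-(s c.1).re) ≤
      a c ^ (-(1 + δ)) * if c.1 ∈ corners D then a c ^ (-(#D * δ)) else P ^ δ := by
    intro c
    split_ifs with hc
    · rw [← Real.rpow_add (ha0 c)]
      refine Real.rpow_le_rpow_of_exponent_le (ha1 c) ?_
      have := h₂ c.1 hc
      linarith
    · calc a c ^ (-(s c.1).re) ≤ a c ^ (-(1 + δ) + δ) :=
            Real.rpow_le_rpow_of_exponent_le (ha1 c) (by have := h₁ c.1 c.2; linarith)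
        _ = a c ^ (-(1 + δ)) * a c ^ δ := Real.rpow_add (ha0 c) _ _
        _ ≤ _ := mul_le_mul_of_nonneg_left (Real.rpow_le_rpow (ha0 c).le (haP c) hδ)
            (Real.rpow_nonneg (ha0 c).le _)
  refine (prod_le_prod (fun c _ => Real.rpow_nonneg (ha0 c).le _) fun c _ => hterm c).trans ?_
  rw [prod_mul_distrib]
  refine mul_le_of_le_one_right (prod_nonneg fun c _ => Real.rpow_nonneg (ha0 c).le _) ?_
  rw [prod_ite, prod_const, Real.finsetProd_rpow _ _ fun c _ => (ha0 c).le, ← hP,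
    ← Real.rpow_mul_natCast hP0.le, ← Real.rpow_add hP0]
  refine Real.rpow_le_one_of_one_le_of_nonpos hP1 ?_
  have hcard : #(univ.filter fun c : D => c.1 ∉ corners D) ≤ #D :=
    (card_filter_le _ _).trans (by simp)
  have hcard' : ((#(univ.filter fun c : D => c.1 ∉ corners D) : ℕ) : ℝ) ≤ #D := by
    exact_mod_cast hcard
  have := mul_le_mul_of_nonneg_left hcard' hδ
  linarith

/-- A finite set of functions lies in the product of its coordinate projections, over which the sum
factorises. -/
theorem summable_prod_pi {ι α : Type*} [Fintype ι] [DecidableEq ι] {f : α → ℝ} (hf : ∀ a, 0 ≤ f a)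
    (hs : Summable f) : Summable fun T : ι → α => ∏ i, f (T i) := by
  classical
  refine summable_of_sum_le (c := ∏ _i : ι, ∑' a, f a) (fun T => prod_nonneg fun i _ => hf _)
    fun u => ?_
  calc ∑ T ∈ u, ∏ i, f (T i)
      ≤ ∑ T ∈ Fintype.piFinset fun i => u.image fun T => T i, ∏ i, f (T i) := by
        refine sum_le_sum_of_subset_of_nonneg (fun T hT => ?_) fun T _ _ =>
          prod_nonneg fun i _ => hf _
        exact Fintype.mem_piFinset.2 fun i => mem_image_of_mem _ hT
    _ = ∏ i, ∑ a ∈ u.image fun T => T i, f a :=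
        (prod_univ_sum (κ := fun _ : ι => α) (fun i => u.image fun T : ι → α => T i)
          fun _ a => f a).symm
    _ ≤ ∏ _i : ι, ∑' a, f a :=
        prod_le_prod (fun i _ => sum_nonneg fun a _ => hf a)
          fun i _ => hs.sum_le_tsum _ fun a _ => hf a

theorem summable_bound (D : Finset Box) {δ : ℝ} (hδ : 0 < δ) :
    Summable fun M : SSYT D => ∏ c : D, ((M.1 c : ℕ) : ℝ) ^ (-(1 + δ)) := by
  have h1 : Summable fun m : ℕ+ => ((m : ℕ) : ℝ) ^ (-(1 + δ)) :=
    (Real.summable_nat_rpow.2 (by linarith)).comp_injective PNat.coe_injective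
  exact (summable_prod_pi (ι := D) (fun m : ℕ+ => Real.rpow_nonneg (Nat.cast_nonneg _) _)
    h1).comp_injective Subtype.val_injective

theorem one_le_re_of_mem_W {D : Finset Box} {s : Box → ℂ} (hs : s ∈ W D) :
    ∀ c ∈ D, 1 ≤ (s c).re := fun c hc => by
  by_cases h : c ∈ corners D
  · exact (hs.2 c h).le
  · exact hs.1 c hc h

theorem exists_margin {D : Finset Box} {s : Box → ℂ} (hs : s ∈ W D) :
    ∃ δ : ℝ, 0 < δ ∧ ∀ c ∈ corners D, 1 + (#D + 1) * δ < (s c).re := by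
  have h : ∀ᶠ δ : ℝ in 𝓝[>] 0, ∀ c ∈ corners D, 1 + (#D + 1) * δ < (s c).re := by
    rw [eventually_all_finset]
    intro c hc
    have ht : Tendsto (fun δ : ℝ => 1 + ((#D : ℝ) + 1) * δ) (𝓝[>] 0) (𝓝 1) := by
      have : Continuous fun δ : ℝ => 1 + ((#D : ℝ) + 1) * δ := by fun_prop
      have := this.tendsto 0
      simp only [mul_zero, add_zero] at this
      exact this.mono_left nhdsWithin_le_nhds
    exact ht.eventually_lt_const (hs.2 c hc)
  obtain ⟨δ, h1, h2⟩ := (h.and self_mem_nhdsWithin).exists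
  exact ⟨δ, h2, h1⟩

/-- The series converges absolutely on the domain `W`. -/
theorem absConv_of_mem_W {D : Finset Box} {s : Box → ℂ} (hs : s ∈ W D) : AbsConv D s := by
  obtain ⟨δ, hδ, h⟩ := exists_margin hs
  exact (summable_bound D hδ).of_nonneg_of_le (fun M => norm_nonneg _) fun M =>
    norm_weight_le hδ.le (one_le_re_of_mem_W hs) (fun c hc => (h c hc).le) M

/-- The Schur multiple zeta-function is continuous on the domain `W`. -/
theorem tendsto_schurZeta {ι : Type*} {l : Filter ι} {D : Finset Box} {s : Box → ℂ}
    {u : ι → Box → ℂ} (hs : s ∈ W D) (hu : ∀ᶠ i in l, u i ∈ W D)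
    (ht : ∀ c ∈ D, Tendsto (fun i => u i c) l (𝓝 (s c))) :
    Tendsto (fun i => schurZeta D (u i)) l (𝓝 (schurZeta D s)) := by
  obtain ⟨δ, hδ, h⟩ := exists_margin hs
  refine tendsto_tsum_of_dominated_convergence (summable_bound D hδ) (fun M => ?_) ?_
  · unfold weight
    refine tendsto_finsetProd _ fun c _ => ?_
    have hM : ((M.1 c : ℕ) : ℂ) ≠ 0 := by exact_mod_cast (M.1 c).ne_zero
    refine Tendsto.div tendsto_const_nhds (Tendsto.const_cpow (ht c.1 c.2) (Or.inl hM)) ?_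
    rw [Complex.cpow_ne_zero_iff]
    exact Or.inl hM
  -- The margin at the corners is strict, so the same `δ`, hence the same majorant, works close to
  -- the limit.
  · have h2 : ∀ᶠ i in l, ∀ c ∈ corners D, 1 + (#D + 1) * δ < (u i c).re := by
      rw [eventually_all_finset]
      intro c hc
      exact ((Complex.continuous_re.tendsto _).comp
        (ht c (mem_filter.1 hc).1)).eventually_const_lt (h c hc)
    filter_upwards [hu, h2] with i hi hi2 M
    exact norm_weight_le hδ.le (one_le_re_of_mem_W hi) (fun c hc => (hi2 c hc).le) M

/-- Enlarging a shape can only destroy corners, so a corner of a laced shape is already a corner of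
the piece it comes from. -/
theorem add_mem_corners_of_image_subset {D E : Finset Box} {t c : Box}
    (h : ∀ b ∈ D, b + t ∈ E) (hc : c ∈ D) (hct : c + t ∈ corners E) : c ∈ corners D := by
  simp only [corners, mem_filter] at hct ⊢
  refine ⟨hc, fun h' => hct.2.1 ?_, fun h' => hct.2.2 ?_⟩
  · have := h _ h'
    rwa [show ((c.1, c.2 + 1) : Box) + t = ((c + t).1, (c + t).2 + 1) by
      ext <;> simp; ring] at this
  · have := h _ h'
    rwa [show ((c.1 + 1, c.2) : Box) + t = ((c + t).1 + 1, (c + t).2) by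
      ext <;> simp; ring] at this

theorem lacedVar_mem_W {A D B : Finset Box} {sA s sB : Box → ℂ} (hA : sA ∈ W A) (hD : s ∈ W D)
    (hB : sB ∈ W B) : lacedVar A D B sA s sB ∈ W (laced A D B) := by
  have hmA : ∀ b ∈ A, b + swShift A D ∈ laced A D B := fun b hb =>
    mem_union_left _ (mem_union_left _ (mem_image_of_mem _ hb))
  have hmD : ∀ b ∈ D, b + 0 ∈ laced A D B := fun b hb =>
    mem_union_left _ (mem_union_right _ (by rwa [add_zero]))
  have hmB : ∀ b ∈ B, b + neShift D B ∈ laced A D B := fun b hb =>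
    mem_union_right _ (mem_image_of_mem _ hb)
  have key : ∀ c ∈ laced A D B, 1 ≤ (lacedVar A D B sA s sB c).re ∧
      (c ∈ corners (laced A D B) → 1 < (lacedVar A D B sA s sB c).re) := by
    intro c hc
    unfold lacedVar
    split_ifs with h1 h2
    · exact ⟨one_le_re_of_mem_W hD c h1, fun h => hD.2 c
        (add_mem_corners_of_image_subset hmD h1 (by rwa [add_zero]))⟩
    · exact ⟨one_le_re_of_mem_W hA _ h2, fun h => hA.2 _
        (add_mem_corners_of_image_subset hmA h2 (by rwa [sub_add_cancel]))⟩
    · have h3 : c - neShift D B ∈ B := by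
        simp only [laced, mem_union, mem_image] at hc
        rcases hc with (⟨b, hb, rfl⟩ | hc) | ⟨b, hb, rfl⟩
        · exact absurd (by rwa [add_sub_cancel_right]) h2
        · exact absurd hc h1
        · rwa [add_sub_cancel_right]
      exact ⟨one_le_re_of_mem_W hB _ h3, fun h => hB.2 _
        (add_mem_corners_of_image_subset hmB h3 (by rwa [sub_add_cancel]))⟩
  exact ⟨fun c hc _ => (key c hc).1, fun c hc => (key c (mem_filter.1 hc).1).2 hc⟩

/-- The factor that the entry `v + 1` contributes to the weight. -/
noncomputable def zetaWeight (s : Box → ℂ) (c : Box) (v : ℕ) : ℂ :=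
  1 / (((v + 1 : ℕ) : ℂ) ^ s c)

/-- The tableau with positive entries attached to a tableau with entries in `Fin n`. -/
def ofFin {D : Finset Box} {n : ℕ} (T : {T : D → Fin n // IsFinSSYT D T}) : SSYT D :=
  ⟨fun c => (T.1 c : ℕ).succPNat, fun a b h h' => Nat.succPNat_le_succPNat.2 (T.2.1 a b h h'),
    fun a b h h' => Nat.succPNat_lt_succPNat.2 (T.2.2 a b h h')⟩

theorem ofFin_injective (D : Finset Box) (n : ℕ) :
    Function.Injective (ofFin : {T : D → Fin n // IsFinSSYT D T} → SSYT D) := by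
  intro T T' h
  refine Subtype.ext (funext fun c => Fin.ext ?_)
  exact Nat.succPNat_inj.1 (congrFun (congrArg Subtype.val h) c)

theorem exists_ofFin_eq {D : Finset Box} {n : ℕ} {M : SSYT D} (h : ∀ c, (M.1 c : ℕ) ≤ n) :
    ∃ T : {T : D → Fin n // IsFinSSYT D T}, ofFin T = M := by
  have hpos : ∀ c, 0 < (M.1 c : ℕ) := fun c => (M.1 c).pos
  refine ⟨⟨fun c => ⟨(M.1 c : ℕ) - 1, by have := h c; have := hpos c; lia⟩,
    fun a b hr hc => ?_, fun a b hc hr => ?_⟩, Subtype.ext (funext fun c => PNat.eq ?_)⟩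
  · have : (M.1 a : ℕ) ≤ M.1 b := M.2.1 a b hr hc
    exact Fin.mk_le_mk.2 (by lia)
  · have h1 : (M.1 a : ℕ) < M.1 b := M.2.2 a b hc hr
    have := hpos a
    exact Fin.mk_lt_mk.2 (by lia)
  · have := hpos c
    simp only [ofFin, Nat.succPNat_coe]
    lia

theorem tendsto_truncSum {D : Finset Box} {s : Box → ℂ} (h : AbsConv D s) :
    Tendsto (fun n => truncSum n D (zetaWeight s)) atTop (𝓝 (schurZeta D s)) := by
  classical
  set F : ℕ → Finset (SSYT D) := fun n =>
    univ.image (ofFin : {T : D → Fin n // IsFinSSYT D T} → SSYT D) with hF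
  have hmem : ∀ n M, M ∈ F n ↔ ∀ c, (M.1 c : ℕ) ≤ n := by
    intro n M
    simp only [hF, mem_image, mem_univ, true_and]
    refine ⟨?_, exists_ofFin_eq⟩
    rintro ⟨T, rfl⟩ c
    exact Nat.succ_le_of_lt (T.1 c).2
  have hsum : ∀ n, truncSum n D (zetaWeight s) = ∑ M ∈ F n, weight D s M := by
    intro n
    rw [sum_image (fun _ _ _ _ e => ofFin_injective D n e), truncSum, ← sum_filter]
    rw [sum_subtype (univ.filter fun T : D → Fin n => IsFinSSYT D T) (p := IsFinSSYT D)
      (by simp) (fun T => ∏ c : D, zetaWeight s c.1 (T c))]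
    rfl
  simp only [hsum]
  -- The tableaux with entries at most `n` exhaust all tableaux: the sum of the entries of `M` is a
  -- sufficient `n`.
  refine (h.of_norm.hasSum).comp (tendsto_atTop_finset_of_monotone (fun n n' hn M hM => ?_)
    fun M => ⟨∑ c, (M.1 c : ℕ), ?_⟩)
  · exact (hmem _ _).2 fun c => ((hmem _ _).1 hM c).trans hn
  · exact (hmem _ _).2 fun c => single_le_sum (f := fun c => (M.1 c : ℕ))
      (fun _ _ => Nat.zero_le _) (mem_univ c)

end Convergence

end LacedSchur

namespace LacedSchur

open Finset

/-! ### Geometry of laced shapes and summation over the attached pieces -/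

section Lacing

/-- `b` is the most north-east box of `D`. -/
def IsNorthEast (D : Finset Box) (b : Box) : Prop :=
  b ∈ D ∧ ∀ c ∈ D, b.1 ≤ c.1 ∧ c.2 ≤ b.2

/-- `b` is the most south-west box of `D`. -/
def IsSouthWest (D : Finset Box) (b : Box) : Prop :=
  b ∈ D ∧ ∀ c ∈ D, c.1 ≤ b.1 ∧ b.2 ≤ c.2

theorem IsNorthEast.neBox_eq {D : Finset Box} {b : Box} (h : IsNorthEast D b) : neBox D = b := by
  refine Prod.ext (IsLeast.csInf_eq ⟨Set.mem_image_of_mem _ h.1, ?_⟩)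
    (IsGreatest.csSup_eq ⟨Set.mem_image_of_mem _ h.1, ?_⟩)
  · rintro _ ⟨c, hc, rfl⟩
    exact (h.2 c hc).1
  · rintro _ ⟨c, hc, rfl⟩
    exact (h.2 c hc).2

theorem IsSouthWest.swBox_eq {D : Finset Box} {b : Box} (h : IsSouthWest D b) : swBox D = b := by
  refine Prod.ext (IsGreatest.csSup_eq ⟨Set.mem_image_of_mem _ h.1, ?_⟩)
    (IsLeast.csInf_eq ⟨Set.mem_image_of_mem _ h.1, ?_⟩)
  · rintro _ ⟨c, hc, rfl⟩
    exact (h.2 c hc).1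
  · rintro _ ⟨c, hc, rfl⟩
    exact (h.2 c hc).2

theorem natBox_mem_youngBoxes {lam : YoungDiagram} {r c : ℕ} :
    natBox r c ∈ youngBoxes lam ↔ (r, c) ∈ lam := by
  simp only [youngBoxes, natBox, mem_image, Prod.mk.injEq, Nat.cast_inj, YoungDiagram.mem_cells]
  constructor
  · rintro ⟨⟨a, b⟩, h, rfl, rfl⟩
    exact h
  · exact fun h => ⟨(r, c), h, rfl, rfl⟩

theorem exists_natBox_of_mem_youngBoxes {lam : YoungDiagram} {b : Box} (hb : b ∈ youngBoxes lam) :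
    ∃ r c, b = natBox r c := by
  simp only [youngBoxes, mem_image] at hb
  obtain ⟨c, _, rfl⟩ := hb
  exact ⟨c.1, c.2, rfl⟩

theorem SkewDiagram.natBox_mem_boxes {θ : SkewDiagram} {r c : ℕ} :
    natBox r c ∈ θ.boxes ↔ (r, c) ∈ θ.outer ∧ (r, c) ∉ θ.inner := by
  rw [SkewDiagram.boxes, mem_sdiff, natBox_mem_youngBoxes, natBox_mem_youngBoxes]

theorem SkewDiagram.exists_natBox {θ : SkewDiagram} {b : Box} (hb : b ∈ θ.boxes) :
    ∃ r c, b = natBox r c :=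
  exists_natBox_of_mem_youngBoxes (mem_sdiff.1 hb).1

/-- `neBox` pairs an extreme row with an extreme column and need not be a box in general. In a skew
diagram the last box of the top non-empty row attains both, because row lengths of the outer diagram
decrease weakly. -/
theorem SkewDiagram.isNorthEast_neBox {θ : SkewDiagram} (h : θ.boxes.Nonempty) :
    IsNorthEast θ.boxes (neBox θ.boxes) := by
  obtain ⟨b, hb, hmin⟩ := exists_min_image θ.boxes Prod.fst h
  obtain ⟨r, c, rfl⟩ := exists_natBox hb
  have hb' := natBox_mem_boxes.1 hb
  have hc := YoungDiagram.mem_iff_lt_rowLen.1 hb'.1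
  have hNE : IsNorthEast θ.boxes (natBox r (θ.outer.rowLen r - 1)) := by
    refine ⟨natBox_mem_boxes.2 ⟨YoungDiagram.mem_iff_lt_rowLen.2 (by lia), fun hin => hb'.2
      (θ.inner.up_left_mem le_rfl (by lia) hin)⟩, fun d hd => ⟨hmin d hd, ?_⟩⟩
    obtain ⟨r', c', rfl⟩ := exists_natBox hd
    have h1 : (r : ℤ) ≤ r' := hmin _ hd
    have h2 : (r, c') ∈ θ.outer :=
      θ.outer.up_left_mem (by lia) le_rfl (natBox_mem_boxes.1 hd).1
    have h3 := YoungDiagram.mem_iff_lt_rowLen.1 h2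
    simp only [natBox]
    lia
  rwa [hNE.neBox_eq]

theorem SkewDiagram.isSouthWest_swBox {θ : SkewDiagram} (h : θ.boxes.Nonempty) :
    IsSouthWest θ.boxes (swBox θ.boxes) := by
  obtain ⟨b, hb, hmin⟩ := exists_min_image θ.boxes Prod.snd h
  obtain ⟨r, c, rfl⟩ := exists_natBox hb
  have hb' := natBox_mem_boxes.1 hb
  have hc := YoungDiagram.mem_iff_lt_colLen.1 hb'.1
  have hSW : IsSouthWest θ.boxes (natBox (θ.outer.colLen c - 1) c) := by
    refine ⟨natBox_mem_boxes.2 ⟨YoungDiagram.mem_iff_lt_colLen.2 (by lia), fun hin => hb'.2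
      (θ.inner.up_left_mem (by lia) le_rfl hin)⟩, fun d hd => ⟨?_, hmin d hd⟩⟩
    obtain ⟨r', c', rfl⟩ := exists_natBox hd
    have h1 : (c : ℤ) ≤ c' := hmin _ hd
    have h2 : (r', c) ∈ θ.outer :=
      θ.outer.up_left_mem le_rfl (by lia) (natBox_mem_boxes.1 hd).1
    have h3 := YoungDiagram.mem_iff_lt_colLen.1 h2
    simp only [natBox]
    lia
  rwa [hSW.swBox_eq]

/-- The pieces `A`, `D`, `B` can be laced. -/
structure Laceable (A D B : Finset Box) : Prop where
  ne_left : A.Nonempty → IsNorthEast A (neBox A)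
  ne_mid : IsNorthEast D (neBox D)
  sw_mid : IsSouthWest D (swBox D)
  sw_right : B.Nonempty → IsSouthWest B (swBox B)

namespace Laceable

variable {A D B : Finset Box}

theorem left_coord (h : Laceable A D B) {a : Box} (ha : a ∈ A) :
    (swBox D).1 ≤ (a + swShift A D).1 ∧ (a + swShift A D).2 < (swBox D).2 := by
  have := (h.ne_left ⟨a, ha⟩).2 a ha
  simp only [swShift, Prod.fst_add, Prod.snd_add, Prod.fst_sub, Prod.snd_sub]
  lia

theorem right_coord (h : Laceable A D B) {b : Box} (hb : b ∈ B) :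
    (b + neShift D B).1 < (neBox D).1 ∧ (neBox D).2 ≤ (b + neShift D B).2 := by
  have := (h.sw_right ⟨b, hb⟩).2 b hb
  simp only [neShift, Prod.fst_add, Prod.snd_add, Prod.fst_sub, Prod.snd_sub]
  lia

theorem mid_coord (h : Laceable A D B) {d : Box} (hd : d ∈ D) :
    (neBox D).1 ≤ d.1 ∧ d.2 ≤ (neBox D).2 ∧ d.1 ≤ (swBox D).1 ∧ (swBox D).2 ≤ d.2 :=
  ⟨(h.ne_mid.2 d hd).1, (h.ne_mid.2 d hd).2, (h.sw_mid.2 d hd).1, (h.sw_mid.2 d hd).2⟩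

/-- The boxes of a laced shape. -/
noncomputable def boxEquiv (h : Laceable A D B) : D ⊕ (A ⊕ B) ≃ laced A D B :=
  Equiv.ofBijective
    (Sum.elim (fun d => ⟨d.1, mem_union_left _ (mem_union_right _ d.2)⟩)
      (Sum.elim
        (fun a => ⟨a.1 + swShift A D,
          mem_union_left _ (mem_union_left _ (mem_image_of_mem _ a.2))⟩)
        (fun b => ⟨b.1 + neShift D B, mem_union_right _ (mem_image_of_mem _ b.2)⟩)))
    (by
      have hmid := h.mid_coord h.sw_mid.1
      constructor
      · rintro (a | a | a) (b | b | b) e <;> replace e := congrArg Subtype.val e <;>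
          simp only [Sum.elim_inl, Sum.elim_inr] at e <;>
          have e1 := congrArg Prod.fst e <;> have e2 := congrArg Prod.snd e
        · rw [Subtype.ext e]
        · have := h.left_coord b.2
          have := h.mid_coord a.2
          lia
        · have := h.right_coord b.2
          have := h.mid_coord a.2
          lia
        · have := h.left_coord a.2
          have := h.mid_coord b.2
          lia
        · rw [Subtype.ext (add_right_cancel e)]
        · have := h.left_coord a.2
          have := h.right_coord b.2
          lia
        · have := h.right_coord a.2
          have := h.mid_coord b.2
          lia
        · have := h.right_coord a.2
          have := h.left_coord b.2
          lia
        · rw [Subtype.ext (add_right_cancel e)]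
      · rintro ⟨c, hc⟩
        simp only [laced, mem_union, mem_image] at hc
        rcases hc with (⟨b, hb, rfl⟩ | hc) | ⟨b, hb, rfl⟩
        · exact ⟨Sum.inr (Sum.inl ⟨b, hb⟩), rfl⟩
        · exact ⟨Sum.inl ⟨c, hc⟩, rfl⟩
        · exact ⟨Sum.inr (Sum.inr ⟨b, hb⟩), rfl⟩)

end Laceable

theorem IsFinSSYT.le_of_row {D : Finset Box} {n : ℕ} {T : D → Fin n} (hT : IsFinSSYT D T)
    {a b : D} (h : a.1.1 = b.1.1) (h' : a.1.2 ≤ b.1.2) : T a ≤ T b := by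
  rcases h'.lt_or_eq with h' | h'
  · exact hT.1 a b h h'
  · rw [Subtype.ext (Prod.ext h h')]

theorem IsFinSSYT.le_of_col {D : Finset Box} {n : ℕ} {T : D → Fin n} (hT : IsFinSSYT D T)
    {a b : D} (h : a.1.2 = b.1.2) (h' : a.1.1 ≤ b.1.1) : T a ≤ T b := by
  rcases h'.lt_or_eq with h' | h'
  · exact (hT.2 a b h h').le
  · rw [Subtype.ext (Prod.ext h' h)]

namespace Laceable

variable {A D B : Finset Box}

/-- By the coordinate bounds `A` and `D` share no column and at most the row of `swBox D`, `B` and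
`D` share no row and at most the column of `neBox D`, and `A` and `B` share neither. So one
comparison at each seam implies all mixed ones. It is vacuous for an empty piece, where `neBox` or
`swBox` is a junk value. -/
theorem isFinSSYT_iff (h : Laceable A D B) {n : ℕ} (T : laced A D B → Fin n) :
    IsFinSSYT (laced A D B) T ↔
      IsFinSSYT D (fun d => T (h.boxEquiv (Sum.inl d))) ∧
      (IsFinSSYT A (fun a => T (h.boxEquiv (Sum.inr (Sum.inl a)))) ∧
        ∀ ha : neBox A ∈ A, (T (h.boxEquiv (Sum.inr (Sum.inl ⟨neBox A, ha⟩))) : ℕ) ≤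
          T (h.boxEquiv (Sum.inl ⟨swBox D, h.sw_mid.1⟩))) ∧
      (IsFinSSYT B (fun b => T (h.boxEquiv (Sum.inr (Sum.inr b)))) ∧
        ∀ hb : swBox B ∈ B, (T (h.boxEquiv (Sum.inr (Sum.inr ⟨swBox B, hb⟩))) : ℕ) <
          T (h.boxEquiv (Sum.inl ⟨neBox D, h.ne_mid.1⟩))) := by
  have eD : ∀ d : D, (h.boxEquiv (Sum.inl d)).1 = d.1 := fun _ => rfl
  have eA : ∀ a : A, (h.boxEquiv (Sum.inr (Sum.inl a))).1 = a.1 + swShift A D := fun _ => rfl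
  have eB : ∀ b : B, (h.boxEquiv (Sum.inr (Sum.inr b))).1 = b.1 + neShift D B := fun _ => rfl
  constructor
  · rintro ⟨hr, hc⟩
    refine ⟨⟨fun a b h1 h2 => hr _ _ h1 h2, fun a b h1 h2 => hc _ _ h1 h2⟩,
      ⟨⟨fun a b h1 h2 => hr _ _ ?_ ?_, fun a b h1 h2 => hc _ _ ?_ ?_⟩, fun ha => hr _ _ ?_ ?_⟩,
      ⟨⟨fun a b h1 h2 => hr _ _ ?_ ?_, fun a b h1 h2 => hc _ _ ?_ ?_⟩, fun hb => hc _ _ ?_ ?_⟩⟩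
    all_goals
      simp only [eD, eA, eB, swShift, neShift, Prod.fst_add, Prod.snd_add, Prod.fst_sub,
        Prod.snd_sub]
      lia
  · rintro ⟨hD, ⟨hA, hAD⟩, hB, hBD⟩
    have hmid := h.mid_coord h.sw_mid.1
    constructor
    · intro x y hxy hlt
      obtain ⟨x, rfl⟩ := h.boxEquiv.surjective x
      obtain ⟨y, rfl⟩ := h.boxEquiv.surjective y
      rcases x with x | x | x <;> rcases y with y | y | y <;> simp only [eD, eA, eB] at hxy hlt
      · exact hD.1 x y hxy hlt
      · have := h.mid_coord x.2
        have := h.left_coord y.2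
        lia
      · have := h.mid_coord x.2
        have := h.right_coord y.2
        lia
      · have h1 := h.mid_coord y.2
        have h2 := h.left_coord x.2
        have hne := h.ne_left ⟨_, x.2⟩
        have h3 := hne.2 x.1 x.2
        have h4 : x.1.1 = (neBox A).1 := by
          have : y.1.1 = (swBox D).1 := by lia
          simp only [swShift, Prod.fst_add, Prod.fst_sub] at hxy
          lia
        have h5 := hA.le_of_row (a := x) (b := ⟨neBox A, hne.1⟩) h4 h3.2
        have h6 := hD.le_of_row (a := ⟨swBox D, h.sw_mid.1⟩) (b := y)
          (by simp only; lia) h1.2.2.2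
        exact h5.trans (le_trans (hAD hne.1) h6)
      · exact hA.1 x y (by simpa using hxy) (by simpa using hlt)
      · have := h.left_coord x.2
        have := h.right_coord y.2
        lia
      · have := h.mid_coord y.2
        have := h.right_coord x.2
        lia
      · have := h.left_coord y.2
        have := h.right_coord x.2
        lia
      · exact hB.1 x y (by simpa using hxy) (by simpa using hlt)
    · intro x y hxy hlt
      obtain ⟨x, rfl⟩ := h.boxEquiv.surjective x
      obtain ⟨y, rfl⟩ := h.boxEquiv.surjective y
      rcases x with x | x | x <;> rcases y with y | y | y <;> simp only [eD, eA, eB] at hxy hlt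
      · exact hD.2 x y hxy hlt
      · have := h.mid_coord x.2
        have := h.left_coord y.2
        lia
      · have := h.mid_coord x.2
        have := h.right_coord y.2
        lia
      · have := h.mid_coord y.2
        have := h.left_coord x.2
        lia
      · exact hA.2 x y (by simpa using hxy) (by simpa using hlt)
      · have := h.left_coord x.2
        have := h.right_coord y.2
        lia
      · have h1 := h.mid_coord y.2
        have h2 := h.right_coord x.2
        have hsw := h.sw_right ⟨_, x.2⟩
        have h3 := hsw.2 x.1 x.2
        have h4 : x.1.2 = (swBox B).2 := by
          have : y.1.2 = (neBox D).2 := by lia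
          simp only [neShift, Prod.snd_add, Prod.snd_sub] at hxy
          lia
        have h5 := hB.le_of_col (a := x) (b := ⟨swBox B, hsw.1⟩) h4 h3.1
        have h6 := hD.le_of_col (a := ⟨neBox D, h.ne_mid.1⟩) (b := y)
          (by simp only; lia) h1.1
        exact lt_of_le_of_lt h5 (lt_of_lt_of_le (hBD hsw.1) h6)
      · have := h.left_coord y.2
        have := h.right_coord x.2
        lia
      · exact hB.2 x y (by simpa using hxy) (by simpa using hlt)

end Laceable

variable {R : Type*} [CommRing R]

/-- The generating function of the tableaux of shape `A` whose most north-east entry is at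
most `v`. -/
noncomputable def swFactor (n : ℕ) (A : Finset Box) (w : Box → ℕ → R) (v : ℕ) : R :=
  open scoped Classical in
  ∑ T : A → Fin n, if IsFinSSYT A T ∧ ∀ h : neBox A ∈ A, (T ⟨neBox A, h⟩ : ℕ) ≤ v then
    ∏ c : A, w c.1 (T c) else 0

/-- The generating function of the tableaux of shape `B` whose most south-west entry is less
than `v`. -/
noncomputable def neFactor (n : ℕ) (B : Finset Box) (w : Box → ℕ → R) (v : ℕ) : R :=
  open scoped Classical in
  ∑ T : B → Fin n, if IsFinSSYT B T ∧ ∀ h : swBox B ∈ B, (T ⟨swBox B, h⟩ : ℕ) < v then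
    ∏ c : B, w c.1 (T c) else 0

theorem swFactor_empty (n : ℕ) (w : Box → ℕ → R) (v : ℕ) : swFactor n ∅ w v = 1 := by
  rw [swFactor, Fintype.sum_unique, if_pos, Fintype.prod_empty]
  exact ⟨⟨fun a => absurd a.2 (notMem_empty _), fun a => absurd a.2 (notMem_empty _)⟩,
    fun h => absurd h (notMem_empty _)⟩

theorem neFactor_empty (n : ℕ) (w : Box → ℕ → R) (v : ℕ) : neFactor n ∅ w v = 1 := by
  rw [neFactor, Fintype.sum_unique, if_pos, Fintype.prod_empty]
  exact ⟨⟨fun a => absurd a.2 (notMem_empty _), fun a => absurd a.2 (notMem_empty _)⟩,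
    fun h => absurd h (notMem_empty _)⟩

/-- Lacing multiplies the weights of the most south-west and the most north-east box. -/
theorem Laceable.truncSum_eq {A D B : Finset Box} (h : Laceable A D B) (n : ℕ)
    (w wA wD wB : Box → ℕ → R) (hA : ∀ a ∈ A, ∀ v, w (a + swShift A D) v = wA a v)
    (hD : ∀ d ∈ D, ∀ v, w d v = wD d v) (hB : ∀ b ∈ B, ∀ v, w (b + neShift D B) v = wB b v) :
    truncSum n (laced A D B) w = truncSum n D fun c v =>
      wD c v * (if c = swBox D then swFactor n A wA v else 1) *
        (if c = neBox D then neFactor n B wB v else 1) := by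
  classical
  unfold truncSum
  rw [sum_fun_eq_sum_sum_sum h.boxEquiv (fun c (v : Fin n) => w c.1 v)]
  refine Finset.sum_congr rfl fun T _ => ?_
  have hiff : ∀ (T₂ : A → Fin n) (T₃ : B → Fin n),
      IsFinSSYT (laced A D B) (Sum.elim T (Sum.elim T₂ T₃) ∘ h.boxEquiv.symm) ↔
      IsFinSSYT D T ∧
      (IsFinSSYT A T₂ ∧ ∀ ha : neBox A ∈ A, (T₂ ⟨neBox A, ha⟩ : ℕ) ≤ T ⟨swBox D, h.sw_mid.1⟩) ∧
      (IsFinSSYT B T₃ ∧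
        ∀ hb : swBox B ∈ B, (T₃ ⟨swBox B, hb⟩ : ℕ) < T ⟨neBox D, h.ne_mid.1⟩) := by
    intro T₂ T₃
    rw [h.isFinSSYT_iff]
    simp only [Function.comp_apply, Equiv.symm_apply_apply, Sum.elim_inl, Sum.elim_inr]
  have e1 : ∏ c : D, w (h.boxEquiv (Sum.inl c)).1 (T c) = ∏ c : D, wD c.1 (T c) :=
    Finset.prod_congr rfl fun c _ => hD c.1 c.2 _
  have e2 : ∀ T₂ : A → Fin n, ∏ c : A, w (h.boxEquiv (Sum.inr (Sum.inl c))).1 (T₂ c) =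
      ∏ c : A, wA c.1 (T₂ c) := fun T₂ => Finset.prod_congr rfl fun c _ => hA c.1 c.2 _
  have e3 : ∀ T₃ : B → Fin n, ∏ c : B, w (h.boxEquiv (Sum.inr (Sum.inr c))).1 (T₃ c) =
      ∏ c : B, wB c.1 (T₃ c) := fun T₃ => Finset.prod_congr rfl fun c _ => hB c.1 c.2 _
  simp only [hiff, e1, e2, e3]
  by_cases hT : IsFinSSYT D T
  -- Only one box has a non-trivial extra factor; with `T` fixed, the sums over the two pieces are
  -- independent.
  · have f1 : ∏ c : D, (if c.1 = swBox D then swFactor n A wA (T c) else 1) =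
        swFactor n A wA (T ⟨swBox D, h.sw_mid.1⟩) := by
      rw [Fintype.prod_eq_single ⟨swBox D, h.sw_mid.1⟩ fun c hc => if_neg fun e =>
        hc (Subtype.ext e), if_pos rfl]
    have f2 : ∏ c : D, (if c.1 = neBox D then neFactor n B wB (T c) else 1) =
        neFactor n B wB (T ⟨neBox D, h.ne_mid.1⟩) := by
      rw [Fintype.prod_eq_single ⟨neBox D, h.ne_mid.1⟩ fun c hc => if_neg fun e =>
        hc (Subtype.ext e), if_pos rfl]
    rw [if_pos hT, prod_mul_distrib, prod_mul_distrib, f1, f2, swFactor, neFactor, mul_assoc,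
      sum_mul_sum, mul_sum]
    refine Finset.sum_congr rfl fun T₂ _ => ?_
    rw [mul_sum]
    refine Finset.sum_congr rfl fun T₃ _ => ?_
    simp only [hT, true_and, ite_and]
    split_ifs <;> simp
  · rw [if_neg hT]
    exact Finset.sum_eq_zero fun T₂ _ => Finset.sum_eq_zero fun T₃ _ => if_neg fun hc => hT hc.1

/-- Lacing for the weights of the Schur multiple zeta-function. -/
theorem Laceable.truncSum_zetaWeight {A D B : Finset Box} (h : Laceable A D B) (n : ℕ)
    (sA s sB : Box → ℂ) :
    truncSum n (laced A D B) (zetaWeight (lacedVar A D B sA s sB)) = truncSum n D fun c v =>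
      zetaWeight s c v * (if c = swBox D then swFactor n A (zetaWeight sA) v else 1) *
        (if c = neBox D then neFactor n B (zetaWeight sB) v else 1) := by
  have hmid := h.mid_coord h.sw_mid.1
  refine h.truncSum_eq n _ _ _ _ (fun a ha v => ?_) (fun d hd v => ?_) (fun b hb v => ?_)
  · have h1 : a + swShift A D ∉ D := fun hd => by
      have := h.mid_coord hd
      have := h.left_coord ha
      lia
    simp only [zetaWeight, lacedVar, if_neg h1, add_sub_cancel_right, if_pos ha]
  · simp only [zetaWeight, lacedVar, if_pos hd]
  · have h1 : b + neShift D B ∉ D := fun hd => by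
      have := h.mid_coord hd
      have := h.right_coord hb
      lia
    have h2 : b + neShift D B - swShift A D ∉ A := fun ha => by
      have h3 := h.left_coord ha
      have := h.right_coord hb
      rw [sub_add_cancel] at h3
      lia
    simp only [zetaWeight, lacedVar, if_neg h1, if_neg h2, add_sub_cancel_right]

end Lacing

end LacedSchur

namespace LacedSchur

open Finset Filter Topology Matrix

/-! ### Frobenius coordinates, the laced Giambelli formula and passage to the limit -/

section Giambelli

/-- The diagonal boxes form an initial segment, so their number is the first missing index. -/
theorem diag_mem_iff_lt_diagLen {lam : YoungDiagram} {i : ℕ} :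
    (i, i) ∈ lam ↔ i < diagLen lam := by
  classical
  have hex : ∃ i, (i, i) ∉ lam := ⟨lam.rowLen 0, fun h => by
    have := YoungDiagram.mem_iff_lt_rowLen.1 (lam.up_left_mem (Nat.zero_le _) le_rfl h)
    lia⟩
  have hk : ∀ i, (i, i) ∈ lam ↔ i < Nat.find hex := fun i => by
    constructor
    · intro h
      by_contra hc
      exact Nat.find_spec hex (lam.up_left_mem (by lia) (by lia) h)
    · intro h
      exact not_not.1 (Nat.find_min hex h)
  have hcard : diagLen lam = Nat.find hex := by
    rw [diagLen, ← card_range (Nat.find hex),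
      ← card_image_of_injective (range (Nat.find hex)) (f := fun i : ℕ => (i, i))
        (fun a b h => (Prod.mk.inj h).1)]
    congr 1
    ext ⟨a, b⟩
    simp only [mem_filter, mem_image, mem_range, YoungDiagram.mem_cells, Prod.mk.injEq]
    constructor
    · rintro ⟨h, rfl⟩
      exact ⟨a, (hk a).1 h, rfl, rfl⟩
    · rintro ⟨c, h, rfl, rfl⟩
      exact ⟨(hk c).2 h, rfl⟩
  rw [hcard, hk]

theorem isFrobenius_youngBoxes (lam : YoungDiagram) :
    IsFrobenius (youngBoxes lam) (diagLen lam) (frobP lam) (frobQ lam) where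
  anti_p i j hij hj := by
    have h1 := lam.rowLen_anti i j hij.le
    have h2 := YoungDiagram.mem_iff_lt_rowLen.1 (diag_mem_iff_lt_diagLen.2 hj)
    simp only [frobP]
    lia
  anti_q i j hij hj := by
    have h1 := lam.colLen_anti i j hij.le
    have h2 := YoungDiagram.mem_iff_lt_colLen.1 (diag_mem_iff_lt_diagLen.2 hj)
    simp only [frobQ]
    lia
  exists_natBox _ hb := exists_natBox_of_mem_youngBoxes hb
  mem_iff r c := by
    rw [natBox_mem_youngBoxes, ← diag_mem_iff_lt_diagLen, ← diag_mem_iff_lt_diagLen, frobP, frobQ]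
    constructor
    · intro h
      rcases Nat.le_total r c with hrc | hrc
      · have h1 := lam.up_left_mem le_rfl hrc h
        rw [YoungDiagram.mem_iff_lt_rowLen] at h
        exact Or.inl ⟨hrc, h1, by lia⟩
      · have h1 := lam.up_left_mem hrc le_rfl h
        rw [YoungDiagram.mem_iff_lt_colLen] at h
        exact Or.inr ⟨hrc, h1, by lia⟩
    · rintro (⟨h1, h2, h3⟩ | ⟨h1, h2, h3⟩)
      · rw [YoungDiagram.mem_iff_lt_rowLen] at h2 ⊢
        lia
      · rw [YoungDiagram.mem_iff_lt_colLen] at h2 ⊢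
        lia

namespace IsFrobenius

variable {D : Finset Box} {N : ℕ} {p q : ℕ → ℕ}

theorem isNorthEast (hD : IsFrobenius D N p q) (hN : 0 < N) : IsNorthEast D (natBox 0 (p 0)) := by
  refine ⟨(hD.mem_iff _ _).2 (by lia), fun b hb => ?_⟩
  obtain ⟨r, c, rfl⟩ := hD.exists_natBox b hb
  simp only [natBox, Nat.cast_le, Nat.zero_le, true_and]
  rcases (hD.mem_iff _ _).1 hb with h | h
  · have := add_index_le_of_anti hD.anti_p (Nat.zero_le r) h.2.1
    lia
  · have := add_index_le_of_anti hD.anti_p (Nat.zero_le c) h.2.1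
    lia

theorem isSouthWest (hD : IsFrobenius D N p q) (hN : 0 < N) : IsSouthWest D (natBox (q 0) 0) := by
  refine ⟨(hD.mem_iff _ _).2 (by lia), fun b hb => ?_⟩
  obtain ⟨r, c, rfl⟩ := hD.exists_natBox b hb
  simp only [natBox, Nat.cast_le, Nat.zero_le, and_true]
  rcases (hD.mem_iff _ _).1 hb with h | h
  · have := add_index_le_of_anti hD.anti_q (Nat.zero_le r) h.2.1
    lia
  · have := add_index_le_of_anti hD.anti_q (Nat.zero_le c) h.2.1
    lia

/-- The content is maximal only where the row is minimal and the column maximal at once. Hence a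
factor at this box can be read as a function of the content. -/
theorem eq_neBox_iff (hD : IsFrobenius D N p q) (hN : 0 < N) {b : Box} (hb : b ∈ D) :
    b = neBox D ↔ b.2 - b.1 = p 0 := by
  rw [(hD.isNorthEast hN).neBox_eq]
  have hle := ((hD.isNorthEast hN).2 b hb)
  constructor
  · rintro rfl
    simp [natBox]
  · intro h
    refine Prod.ext ?_ ?_ <;> simp only [natBox] at hle ⊢ <;> lia

theorem eq_swBox_iff (hD : IsFrobenius D N p q) (hN : 0 < N) {b : Box} (hb : b ∈ D) :
    b = swBox D ↔ b.2 - b.1 = -q 0 := by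
  rw [(hD.isSouthWest hN).swBox_eq]
  have hle := ((hD.isSouthWest hN).2 b hb)
  constructor
  · rintro rfl
    simp [natBox]
  · intro h
    refine Prod.ext ?_ ?_ <;> simp only [natBox] at hle ⊢ <;> lia

theorem content_mem_Icc (hD : IsFrobenius D N p q) (hN : 0 < N) {b : Box} (hb : b ∈ D) :
    -(q 0 : ℤ) ≤ b.2 - b.1 ∧ b.2 - b.1 ≤ p 0 := by
  have h1 := (hD.isNorthEast hN).2 b hb
  have h2 := (hD.isSouthWest hN).2 b hb
  simp only [natBox] at h1 h2
  lia

theorem laceable (hD : IsFrobenius D N p q) (hN : 0 < N) {A B : Finset Box}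
    (hA : A.Nonempty → IsNorthEast A (neBox A)) (hB : B.Nonempty → IsSouthWest B (swBox B)) :
    Laceable A D B where
  ne_left := hA
  ne_mid := by
    have := hD.isNorthEast hN
    rwa [this.neBox_eq]
  sw_mid := by
    have := hD.isSouthWest hN
    rwa [this.swBox_eq]
  sw_right := hB

end IsFrobenius

theorem eq_contentVar_of_mem_Wdiag {lam : YoungDiagram} {s : Box → ℂ} (hs : s ∈ Wdiag lam) {b : Box}
    (hb : b ∈ youngBoxes lam) : s b = contentVar s (b.2 - b.1) := by
  have hF := isFrobenius_youngBoxes lam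
  obtain ⟨r, c, rfl⟩ := hF.exists_natBox b hb
  unfold contentVar
  rcases Nat.lt_or_ge c r with h | h
  · rw [if_neg (by simp only [natBox]; lia)]
    obtain ⟨k, rfl⟩ : ∃ k, r = c + k := ⟨r - c, by lia⟩
    have hm : natBox k 0 ∈ youngBoxes lam := natBox_mem_youngBoxes.2
      (lam.up_left_mem (by lia) (by lia) (natBox_mem_youngBoxes.1 hb))
    have e : ((-((natBox (c + k) c).2 - (natBox (c + k) c).1), 0) : Box) = natBox k 0 := by
      simp [natBox]
    rw [e]
    exact hs.2 _ hb _ hm (by simp [natBox])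
  · rw [if_pos (by simp only [natBox]; lia)]
    obtain ⟨k, rfl⟩ : ∃ k, c = r + k := ⟨c - r, by lia⟩
    have hm : natBox 0 k ∈ youngBoxes lam := natBox_mem_youngBoxes.2
      (lam.up_left_mem (by lia) (by lia) (natBox_mem_youngBoxes.1 hb))
    have e : ((0, (natBox r (r + k)).2 - (natBox r (r + k)).1) : Box) = natBox 0 k := by
      simp [natBox]
    rw [e]
    exact hs.2 _ hb _ hm (by simp [natBox])

/-- The content weights that absorb the pieces attached to a Young diagram. -/
noncomputable def lacedContentWeight (n : ℕ) (lam : YoungDiagram) (A B : Finset Box)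
    (sA s sB : Box → ℂ) (k : ℤ) (v : ℕ) : ℂ :=
  1 / (((v + 1 : ℕ) : ℂ) ^ contentVar s k) *
    (if k = -(frobQ lam 0 : ℤ) then swFactor n A (zetaWeight sA) v else 1) *
    (if k = (frobP lam 0 : ℤ) then neFactor n B (zetaWeight sB) v else 1)

variable {lam : YoungDiagram} {A B : Finset Box}

theorem truncSum_laced_youngBoxes (hN : 0 < diagLen lam)
    (hA : A.Nonempty → IsNorthEast A (neBox A)) (hB : B.Nonempty → IsSouthWest B (swBox B))
    {s : Box → ℂ} (hs : s ∈ Wdiag lam) (sA sB : Box → ℂ) (n : ℕ) :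
    truncSum n (laced A (youngBoxes lam) B)
        (zetaWeight (lacedVar A (youngBoxes lam) B sA s sB)) =
      truncSum n (youngBoxes lam) fun c => lacedContentWeight n lam A B sA s sB (c.2 - c.1) := by
  have hF := isFrobenius_youngBoxes lam
  rw [(hF.laceable hN hA hB).truncSum_zetaWeight]
  refine truncSum_congr fun c hc v => ?_
  simp only [hF.eq_neBox_iff hN hc, hF.eq_swBox_iff hN hc, lacedContentWeight, zetaWeight,
    eq_contentVar_of_mem_Wdiag hs hc]

/-- The contents of the hook fill the range from `-q_j` to `p_i`. By strict decrease the extreme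
values `-q_0` and `p_0` are out of reach unless `j = 0` or `i = 0`, so one family of content weights
serves all hooks and the whole diagram. -/
theorem truncSum_lacedHook (hA : A.Nonempty → IsNorthEast A (neBox A))
    (hB : B.Nonempty → IsSouthWest B (swBox B)) (sA s sB : Box → ℂ) (n : ℕ)
    (i j : Fin (diagLen lam)) :
    truncSum n (lacedHook lam A B i j) (zetaWeight (lacedHookVar lam A B sA s sB i j)) =
      truncSum n (hook (frobP lam i) (frobQ lam j))
        fun c => lacedContentWeight n lam A B sA s sB (c.2 - c.1) := by
  have hF := isFrobenius_hook (frobP lam i) (frobQ lam j)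
  have hY := isFrobenius_youngBoxes lam
  have hA' : (swPart A j).Nonempty → IsNorthEast (swPart A j) (neBox (swPart A j)) := by
    unfold swPart
    split_ifs
    · exact hA
    · exact fun h => absurd h not_nonempty_empty
  have hB' : (nePart B i).Nonempty → IsSouthWest (nePart B i) (swBox (nePart B i)) := by
    unfold nePart
    split_ifs
    · exact hB
    · exact fun h => absurd h not_nonempty_empty
  rw [lacedHook, lacedHookVar, (hF.laceable one_pos hA' hB').truncSum_zetaWeight]
  refine truncSum_congr fun c hc v => ?_
  have hcont := hF.content_mem_Icc one_pos hc
  simp only [hF.eq_neBox_iff one_pos hc, hF.eq_swBox_iff one_pos hc, lacedContentWeight,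
    zetaWeight, hookVar]
  congr 1
  · congr 1
    rcases Nat.eq_zero_or_pos (j : ℕ) with hj | hj
    · rw [swPart, if_pos hj, hj]
    · have := hY.anti_q 0 j hj j.2
      rw [swPart, if_neg hj.ne', swFactor_empty, ite_self, if_neg (by lia)]
  · rcases Nat.eq_zero_or_pos (i : ℕ) with hi | hi
    · rw [nePart, if_pos hi, hi]
    · have := hY.anti_p 0 i hi i.2
      rw [nePart, if_neg hi.ne', neFactor_empty, ite_self, if_neg (by lia)]

/-- The Giambelli formula for truncated series. -/
theorem truncSum_laced_eq_det (hN : 0 < diagLen lam)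
    (hA : A.Nonempty → IsNorthEast A (neBox A)) (hB : B.Nonempty → IsSouthWest B (swBox B))
    {s : Box → ℂ} (hs : s ∈ Wdiag lam) (sA sB : Box → ℂ) (n : ℕ) :
    truncSum n (laced A (youngBoxes lam) B)
        (zetaWeight (lacedVar A (youngBoxes lam) B sA s sB)) =
      det (of fun i j : Fin (diagLen lam) =>
        truncSum n (lacedHook lam A B i j) (zetaWeight (lacedHookVar lam A B sA s sB i j))) := by
  rw [truncSum_laced_youngBoxes hN hA hB hs, truncSum_eq_det_hook (isFrobenius_youngBoxes lam)]
  simp only [truncSum_lacedHook hA hB]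

theorem lacedHookVar_mem_W {sA s sB : Box → ℂ} (hA : sA ∈ W A) (hB : sB ∈ W B)
    (hs : HooksInW lam s) (i j : Fin (diagLen lam)) :
    lacedHookVar lam A B sA s sB i j ∈ W (lacedHook lam A B i j) := by
  have hempty : ∀ t : Box → ℂ, t ∈ W ∅ := fun t =>
    ⟨fun c hc => absurd hc (notMem_empty c),
      fun c hc => absurd (mem_filter.1 hc).1 (notMem_empty c)⟩
  refine lacedVar_mem_W ?_ (hs i j) ?_
  · unfold swPart
    split_ifs
    exacts [hA, hempty _]
  · unfold nePart
    split_ifs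
    exacts [hB, hempty _]

/-- The Giambelli formula for laced Schur multiple zeta-functions. -/
theorem schurZeta_laced_eq_det (hN : 0 < diagLen lam)
    (hA : A.Nonempty → IsNorthEast A (neBox A)) (hB : B.Nonempty → IsSouthWest B (swBox B))
    {sA s sB : Box → ℂ} (hsA : sA ∈ W A) (hsB : sB ∈ W B) (hs : s ∈ Wdiag lam)
    (hH : HooksInW lam s) :
    schurZeta (laced A (youngBoxes lam) B) (lacedVar A (youngBoxes lam) B sA s sB) =
      (giambelliMatrix lam A B sA s sB).det := by
  have h1 := tendsto_truncSum (absConv_of_mem_W (lacedVar_mem_W hsA hs.1 hsB))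
  have h2 : Tendsto (fun n => det (of fun i j : Fin (diagLen lam) =>
      truncSum n (lacedHook lam A B i j) (zetaWeight (lacedHookVar lam A B sA s sB i j))))
      atTop (𝓝 (giambelliMatrix lam A B sA s sB).det) := by
    refine ((continuous_id.matrix_det).tendsto _).comp ?_
    refine tendsto_pi_nhds.2 fun i => tendsto_pi_nhds.2 fun j => ?_
    exact tendsto_truncSum (absConv_of_mem_W (lacedHookVar_mem_W hsA hsB hH i j))
  simp only [truncSum_laced_eq_det hN hA hB hs] at h1
  exact tendsto_nhds_unique h1 h2

end Giambelli

end LacedSchur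

/-! ### The theorem -/

theorem theorem2p1 (lam : YoungDiagram) (hlam : lam ≠ ⊥)
    (lsw lne : LacedSchur.SkewDiagram)
    (s ssw sne : LacedSchur.Box → ℂ)
    (hs : s ∈ LacedSchur.Wdiag lam)
    (hsw : ssw ∈ LacedSchur.W lsw.boxes)
    (hne : sne ∈ LacedSchur.W lne.boxes) :
    -- the series of the laced tableau converges absolutely
    LacedSchur.AbsConv
      (LacedSchur.laced lsw.boxes (LacedSchur.youngBoxes lam) lne.boxes)
      (LacedSchur.lacedVar lsw.boxes (LacedSchur.youngBoxes lam) lne.boxes ssw s sne) ∧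
    -- where the hook variables lie in the hook domains, all entries converge absolutely
    -- and the determinant formula holds
    (LacedSchur.HooksInW lam s →
      (∀ i j : Fin (LacedSchur.diagLen lam),
        LacedSchur.AbsConv (LacedSchur.lacedHook lam lsw.boxes lne.boxes i j)
          (LacedSchur.lacedHookVar lam lsw.boxes lne.boxes ssw s sne i j)) ∧
      LacedSchur.schurZeta
          (LacedSchur.laced lsw.boxes (LacedSchur.youngBoxes lam) lne.boxes)
          (LacedSchur.lacedVar lsw.boxes (LacedSchur.youngBoxes lam) lne.boxes ssw s sne) =
        (LacedSchur.giambelliMatrix lam lsw.boxes lne.boxes ssw s sne).det) ∧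
    -- on all of `W_λ^diag` it holds for the extension of the determinant from that region
    Filter.Tendsto
      (fun s' : LacedSchur.Box → ℂ =>
        (LacedSchur.giambelliMatrix lam lsw.boxes lne.boxes ssw s' sne).det)
      (nhdsWithin s {s' | s' ∈ LacedSchur.Wdiag lam ∧ LacedSchur.HooksInW lam s'})
      (nhds (LacedSchur.schurZeta
        (LacedSchur.laced lsw.boxes (LacedSchur.youngBoxes lam) lne.boxes)
        (LacedSchur.lacedVar lsw.boxes (LacedSchur.youngBoxes lam) lne.boxes ssw s sne))) := by
  have hN : 0 < LacedSchur.diagLen lam := by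
    rw [← LacedSchur.diag_mem_iff_lt_diagLen]
    by_contra h
    refine hlam (le_bot_iff.1 fun c hc => absurd ?_ h)
    exact lam.up_left_mem (Nat.zero_le _) (Nat.zero_le _) hc
  refine ⟨LacedSchur.absConv_of_mem_W (LacedSchur.lacedVar_mem_W hsw hs.1 hne), fun hH =>
    ⟨fun i j => LacedSchur.absConv_of_mem_W (LacedSchur.lacedHookVar_mem_W hsw hne hH i j),
      LacedSchur.schurZeta_laced_eq_det hN LacedSchur.SkewDiagram.isNorthEast_neBox
        LacedSchur.SkewDiagram.isSouthWest_swBox hsw hne hs hH⟩, ?_⟩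
  -- The laced zeta-function is continuous on its whole domain, and on the restricted region it
  -- equals the determinant; so the determinant inherits the limit.
  have hlim := LacedSchur.tendsto_schurZeta
    (l := nhdsWithin s {s' | s' ∈ LacedSchur.Wdiag lam ∧ LacedSchur.HooksInW lam s'})
    (u := fun s' => LacedSchur.lacedVar lsw.boxes (LacedSchur.youngBoxes lam) lne.boxes ssw s' sne)
    (LacedSchur.lacedVar_mem_W hsw hs.1 hne)
    (by
      filter_upwards [self_mem_nhdsWithin] with s' hs'
      exact LacedSchur.lacedVar_mem_W hsw hs'.1.1 hne)
    -- Which piece a box belongs to does not depend on the variables, so coordinatewise convergence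
    -- is enough.
    (fun c _ => by
      simp only [LacedSchur.lacedVar]
      split_ifs
      · exact ((continuous_apply c).tendsto s).mono_left nhdsWithin_le_nhds
      · exact tendsto_const_nhds
      · exact tendsto_const_nhds)
  refine hlim.congr' ?_
  filter_upwards [self_mem_nhdsWithin] with s' hs'
  exact LacedSchur.schurZeta_laced_eq_det hN LacedSchur.SkewDiagram.isNorthEast_neBox
    LacedSchur.SkewDiagram.isSouthWest_swBox hsw hne hs'.1 hs'.2
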